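/- **Setting.** Let $\mathcal G$ be the graph with two nodes and weights $q_{12}=q_{21}=1$, $q_{11}=q_{22}=0$, and let $\Omega=\mathbb R$. Let $\mathcal P(\mathbb R\times\mathcal G)$ be the set of pairs $\boldsymbol\mu=(\mu_1,\mu_2)$ of finite Borel measures on $\mathbb R$ with $\mu_1(\mathbb R)+\mu_2(\mathbb R)=1$, and $\mathcal P_2(\mathbb R\times\mathcal G)$ the subset with finite second moments. Put $\bar\rho=\rho_1+\rho_2$. An interpolation function $\theta:[0,\infty)^2\to[0,\infty)$ is *admissible* if it is continuous, $C^\infty$ on $(0,\infty)^2$, symmetric, positive on $(0,\infty)^2$, $\theta(1,1)=1$, nondecreasing in each variable, positively $1$-homogeneous and concave. Write $\theta_{ij}(\boldsymbol\rho)=\theta\big(\tfrac{d\rho_i}{d\bar\rho},\tfrac{d\rho_j}{d\bar\rho}\big)$. * $d_{BL}(\boldsymbol\mu,\boldsymbol\nu)=\big(\sum_i\|\mu_i-\nu_i\|_{BL}^2\big)^{1/2}$, where $\|\mu_i-\nu_i\|_{BL}=\sup\{\int\eta\,d(\mu_i-\nu_i):\eta\in C_c^\infty(\mathbb R),\ \|\eta\|_\infty^2+\|\eta'\|_\infty^2\le1\}$;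 $Q=\max_i\sum_jq_{ij}$ (here $Q=1$). * $W^2(\boldsymbol\mu,\boldsymbol\nu)$ is the infimum of $\int_0^1\big[\sum_i\int|u_i|^2d\rho_i+\frac12\sum_{i,j}\int|v_{ij}|^2\theta_{ij}(\boldsymbol\rho)q_{ij}\,d\bar\rho\big]dt$ over narrowly continuous curves $\boldsymbol\rho:[0,1]\to\mathcal P(\mathbb R\times\mathcal G)$ from $\boldsymbol\mu$ to $\boldsymbol\nu$ and measurable $u_i,v_{ij}$ with $\int_0^1\!\int|u_i|\,d\rho_i\,dt<\infty$ and $\int_0^1\!\int|v_{ij}|\,\theta_{ij}(\boldsymbol\rho)\,d\bar\rho\,dt<\infty$ that solve, in the sense of distributions on $\mathbb R\times(0,1)$, $\partial_t\rho_i+\partial_x(u_i\rho_i)=\frac12\sum_j\theta_{ij}(\boldsymbol\rho)(v_{ij}-v_{ji})q_{ij}\,\bar\rho$ for each $i$. * For $p,\tilde p$ in the simplex $\Delta$ of probability vectors on $\{1,2\}$, $d_\Delta^2(p,\tilde p)$ is the infimum of $\int_0^1\frac12\sum_{i,j}v_{ij}^2\theta(p_i,p_j)q_{ij}\,dt$ over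 continuous curves $p:[0,1]\to\Delta$ from $p$ to $\tilde p$ and measurable $v_{ij}$ with $\theta(p_i,p_j)v_{ij}\in L^1_{loc}(0,1)$ and $\dot p_i=\frac12\sum_j\theta(p_i,p_j)(v_{ij}-v_{ji})q_{ij}$ in the sense of distributions on $(0,1)$. Let $W_{\mathbb R\times\Delta}$ be the $2$-Wasserstein distance on $\mathcal P(\mathbb R\times\Delta)$ for the ground distance $(|x-\tilde x|^2+d_\Delta^2(p,\tilde p))^{1/2}$. * For $\lambda\in\mathcal P(\mathbb R\times\Delta)$, $\mathfrak P\lambda$ is the element of $\mathcal P(\mathbb R\times\mathcal G)$ whose $i$-th component is the marginal on $\mathbb R$ of the measure $p_i\,d\lambda(x,p)$. Put $D(\boldsymbol\mu,\boldsymbol\nu)=\inf\{W_{\mathbb R\times\Delta}(\lambda_1,\lambda_2):\mathfrak P\lambda_1=\boldsymbol\mu,\ \mathfrak P\lambda_2=\boldsymbol\nu\}$ and $W_{2,\mathcal W}(\boldsymbol\mu,\boldsymbol\nu)=W_{\mathbb R\times\Delta}(\sum_j\mu_j\otimes\delta_{e_j},\sum_j\nu_j\otimes\delta_{e_j})$,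 where $e_1,e_2$ are the vertices of $\Delta$. **Proposition.** There is an admissible $\theta$ such that: 1. For each of the three inequalities between consecutive terms of the chain $$\min\{1,Q^{-1/2}\}\,d_{BL}\ \le\ W\ \le\ D\ \le\ W_{2,\mathcal W},$$ the constant is sharp, in the sense that there are $\boldsymbol\mu,\boldsymbol\nu\in\mathcal P_2(\mathbb R\times\mathcal G)$ for which equality holds with both sides positive and finite; and there are $\boldsymbol\mu,\boldsymbol\nu\in\mathcal P_2(\mathbb R\times\mathcal G)$ for which the inequality is strict, with finite right-hand side. 2. $D$ fails the triangle inequality: there are $\boldsymbol\mu,\boldsymbol\nu,\boldsymbol\sigma\in\mathcal P_2(\mathbb R\times\mathcal G)$ with $D(\boldsymbol\mu,\boldsymbol\nu)+D(\boldsymbol\nu,\boldsymbol\sigma)<D(\boldsymbol\mu,\boldsymbol\sigma)$. -/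

import Mathlib

open MeasureTheory Set
open scoped ENNReal ContDiff BoundedContinuousFunction

noncomputable section

namespace VVOT

/-- Admissible interpolation functions `θ : [0,∞) × [0,∞) → [0,∞)`. The values of `θ` outside the
closed quadrant are irrelevant. -/
structure IsInterpolation (θ : ℝ → ℝ → ℝ) : Prop where
  nonneg : ∀ s t, 0 ≤ s → 0 ≤ t → 0 ≤ θ s t
  continuousOn : ContinuousOn (fun z : ℝ × ℝ => θ z.1 z.2) (Ici 0 ×ˢ Ici 0)
  smooth : ContDiffOn ℝ ∞ (fun z : ℝ × ℝ => θ z.1 z.2) (Ioi 0 ×ˢ Ioi 0)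
  symm : ∀ s t, 0 ≤ s → 0 ≤ t → θ s t = θ t s
  pos : ∀ s t, 0 < s → 0 < t → 0 < θ s t
  normalized : θ 1 1 = 1
  mono : ∀ r s t, 0 ≤ r → r ≤ s → 0 ≤ t → θ r t ≤ θ s t
  homogeneous : ∀ c s t, 0 < c → 0 ≤ s → 0 ≤ t → θ (c * s) (c * t) = c * θ s t
  concave : ConcaveOn ℝ (Ici 0 ×ˢ Ici 0) (fun z : ℝ × ℝ => θ z.1 z.2)

/-- The two-node graph with unit edge weight `q₁₂ = q₂₁ = 1` (and no self-loops). -/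
def twoNode : Fin 2 → Fin 2 → ℝ := fun i j => if i = j then 0 else 1

section Graph

variable {n : ℕ}

/-- Probability measures on the node set; this is also the simplex `Δ^{n-1}`, under the bijection
that appends the last barycentric coordinate. -/
abbrev Simplex (n : ℕ) : Type := stdSimplex ℝ (Fin n)

/-- The vertex `e_j` of the simplex, i.e. the Dirac mass at node `j`. -/
def vertex (j : Fin n) : Simplex n := ⟨Pi.single j 1, single_mem_stdSimplex ℝ j⟩

/-- `(p, v)` solves the graph continuity equation `∂ₜ p + ∇_𝒢 · (θ(p_i, p_j) v) = 0` on `[0,1]`,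
where `(∇_𝒢 · m)_i = -½ ∑_j (m_ij - m_ji) q_ij`. The equation is understood in the sense of
distributions on `(0,1)`. Only the values for `t ∈ [0,1]` matter. -/
structure GraphContinuityEq (θ : ℝ → ℝ → ℝ) (q : Fin n → Fin n → ℝ)
    (p : ℝ → Fin n → ℝ) (v : ℝ → Fin n → Fin n → ℝ) : Prop where
  mem_simplex : ∀ t ∈ Icc (0 : ℝ) 1, p t ∈ stdSimplex ℝ (Fin n)
  continuousOn : ContinuousOn p (Icc 0 1)
  measurable : Measurable v
  locallyIntegrable : ∀ i j,
    LocallyIntegrableOn (fun t => θ (p t i) (p t j) * v t i j) (Ioo 0 1) volume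
  equation : ∀ φ : ℝ → ℝ, ContDiff ℝ ∞ φ → HasCompactSupport φ → tsupport φ ⊆ Ioo 0 1 →
    ∀ i, ∫ t in Icc (0 : ℝ) 1, deriv φ t * p t i =
      ∫ t in Icc (0 : ℝ) 1, φ t * (-(1 / 2) * ∑ j,
        (θ (p t i) (p t j) * v t i j - θ (p t j) (p t i) * v t j i) * q i j)

/-- The squared tangent norm `½ ∑ |v_ij|² θ(p_i, p_j) q_ij`. -/
def graphTanNormSq (θ : ℝ → ℝ → ℝ) (q : Fin n → Fin n → ℝ)
    (p : Fin n → ℝ) (v : Fin n → Fin n → ℝ) : ℝ :=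
  1 / 2 * ∑ i, ∑ j, (v i j) ^ 2 * θ (p i) (p j) * q i j

/-- The squared graph Wasserstein distance `W_𝒢²(p₀, p₁)`. -/
def graphWSq (θ : ℝ → ℝ → ℝ) (q : Fin n → Fin n → ℝ) (p₀ p₁ : Fin n → ℝ) : ℝ≥0∞ :=
  ⨅ (p : ℝ → Fin n → ℝ) (v : ℝ → Fin n → Fin n → ℝ)
    (_ : GraphContinuityEq θ q p v) (_ : p 0 = p₀) (_ : p 1 = p₁),
    ∫⁻ t in Icc (0 : ℝ) 1, ENNReal.ofReal (graphTanNormSq θ q (p t) (v t))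

end Graph

section VectorValued

variable {n : ℕ}

/-- `𝒫(ℝ × 𝒢)`: vectors of (finite) measures on `ℝ` of total mass one. -/
def IsVVProb (μ : Fin n → Measure ℝ) : Prop := ∑ i, μ i univ = 1

/-- `𝒫₂(ℝ × 𝒢)`: finite second moments. -/
def IsVVProb₂ (μ : Fin n → Measure ℝ) : Prop :=
  IsVVProb μ ∧ ∀ i, ∫⁻ x, ENNReal.ofReal (x ^ 2) ∂(μ i) < ⊤

/-- The sum `ρ̄` of the components. -/
def total (ρ : Fin n → Measure ℝ) : Measure ℝ := ∑ i, ρ i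

/-- The Radon-Nikodym density `dρ_i / dρ̄`. -/
def dens (ρ : Fin n → Measure ℝ) (i : Fin n) (x : ℝ) : ℝ := ((ρ i).rnDeriv (total ρ) x).toReal

/-- `θ(dρ_i/dρ̄, dρ_j/dρ̄)`. -/
def edgeDens (θ : ℝ → ℝ → ℝ) (ρ : Fin n → Measure ℝ) (i j : Fin n) (x : ℝ) : ℝ :=
  θ (dens ρ i x) (dens ρ j x)

/-! ### Bounded Lipschitz distance -/

/-- The norm `(‖η‖_{L^∞}² + ‖η'‖_{L^∞}²)^{1/2}`. -/
def W1infNorm (η : ℝ → ℝ) : ℝ≥0∞ :=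
  (eLpNorm η ⊤ volume ^ 2 + eLpNorm (deriv η) ⊤ volume ^ 2) ^ (1 / 2 : ℝ)

/-- The dual norm `‖μ - ν‖_BL` for finite measures; the competitor `η = 0` makes it nonnegative, so
truncating the integrals below at `0` does not change the supremum. -/
def normBL (μ ν : Measure ℝ) : ℝ≥0∞ :=
  ⨆ (η : ℝ → ℝ) (_ : ContDiff ℝ ∞ η) (_ : HasCompactSupport η) (_ : W1infNorm η ≤ 1),
    ENNReal.ofReal (∫ x, η x ∂μ - ∫ x, η x ∂ν)

/-- The bounded Lipschitz distance `d_BL`. -/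
def dBL (μ ν : Fin n → Measure ℝ) : ℝ≥0∞ :=
  (∑ i, normBL (μ i) (ν i) ^ 2) ^ (1 / 2 : ℝ)

/-- The constant `min {1, Q^{-1/2}}`, where `Q = max_i ∑_j q_ij`. -/
def constBL (q : Fin n → Fin n → ℝ) : ℝ≥0∞ :=
  ENNReal.ofReal (min 1 ((⨆ i, ∑ j, q i j) ^ (-(1 / 2) : ℝ)))

/-! ### Dynamic distance -/

/-- `(ρ, u, v)` solves the vector valued continuity equation on `ℝ × [0,1]`, with `u i x t` and
`v i j x t`. Test functions `η (x, t)` are smooth with compact support in `ℝ × (0,1)`. Only the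
values for `t ∈ [0,1]` matter. -/
structure VVContinuityEq (θ : ℝ → ℝ → ℝ) (q : Fin n → Fin n → ℝ)
    (ρ : ℝ → Fin n → Measure ℝ) (u : Fin n → ℝ → ℝ → ℝ)
    (v : Fin n → Fin n → ℝ → ℝ → ℝ) : Prop where
  isVVProb : ∀ t ∈ Icc (0 : ℝ) 1, IsVVProb (ρ t)
  narrow_continuous : ∀ i, ∀ f : ℝ →ᵇ ℝ, ContinuousOn (fun t => ∫ x, f x ∂(ρ t i)) (Icc 0 1)
  measurable_u : ∀ i, Measurable (fun z : ℝ × ℝ => u i z.1 z.2)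
  integrable_u : ∀ i, ∫⁻ t in Icc (0 : ℝ) 1, ∫⁻ x, ENNReal.ofReal |u i x t| ∂(ρ t i) < ⊤
  measurable_v : ∀ i j, Measurable (fun z : ℝ × ℝ => v i j z.1 z.2)
  integrable_v : ∀ i j, ∫⁻ t in Icc (0 : ℝ) 1,
    ∫⁻ x, ENNReal.ofReal (|v i j x t| * edgeDens θ (ρ t) i j x) ∂(total (ρ t)) < ⊤
  equation : ∀ η : ℝ × ℝ → ℝ, ContDiff ℝ ∞ η → HasCompactSupport η →
    tsupport η ⊆ univ ×ˢ Ioo 0 1 → ∀ i,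
      ∫ t in Icc (0 : ℝ) 1, ∫ x, deriv (fun s => η (x, s)) t ∂(ρ t i) =
        - (∫ t in Icc (0 : ℝ) 1, ∫ x, deriv (fun y => η (y, t)) x * u i x t ∂(ρ t i))
        - 1 / 2 * ∑ j, ∫ t in Icc (0 : ℝ) 1,
            ∫ x, η (x, t) * edgeDens θ (ρ t) i j x * (v i j x t - v j i x t) * q i j
              ∂(total (ρ t))

/-- The squared norm `‖(u, v)‖²_ρ` at a fixed time. -/
def vvNormSq (θ : ℝ → ℝ → ℝ) (q : Fin n → Fin n → ℝ) (ρ : Fin n → Measure ℝ)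
    (u : Fin n → ℝ → ℝ) (v : Fin n → Fin n → ℝ → ℝ) : ℝ≥0∞ :=
  ∑ i, ∫⁻ x, ENNReal.ofReal ((u i x) ^ 2) ∂(ρ i) +
    1 / 2 * ∑ i, ∑ j,
      ∫⁻ x, ENNReal.ofReal ((v i j x) ^ 2 * edgeDens θ ρ i j x * q i j) ∂(total ρ)

/-- The dynamic distance `W_{ℝ × 𝒢}`. -/
def dynW (θ : ℝ → ℝ → ℝ) (q : Fin n → Fin n → ℝ) (μ ν : Fin n → Measure ℝ) : ℝ≥0∞ :=
  (⨅ (ρ : ℝ → Fin n → Measure ℝ) (u : Fin n → ℝ → ℝ → ℝ) (v : Fin n → Fin n → ℝ → ℝ → ℝ)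
    (_ : VVContinuityEq θ q ρ u v) (_ : ρ 0 = μ) (_ : ρ 1 = ν),
    ∫⁻ t in Icc (0 : ℝ) 1,
      vvNormSq θ q (ρ t) (fun i x => u i x t) (fun i j x => v i j x t)) ^ (1 / 2 : ℝ)

/-! ### Static (semi-)distances -/

/-- The squared ground distance `|x - y|² + d_Δ²(r, s)` on `ℝ × Δ^{n-1}`. -/
def groundSq (θ : ℝ → ℝ → ℝ) (q : Fin n → Fin n → ℝ) (z w : ℝ × Simplex n) : ℝ≥0∞ :=
  ENNReal.ofReal ((z.1 - w.1) ^ 2) + graphWSq θ q z.2.1 w.2.1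

/-- The 2-Wasserstein distance on `𝒫(ℝ × Δ^{n-1})` for the product ground distance. -/
def liftW (θ : ℝ → ℝ → ℝ) (q : Fin n → Fin n → ℝ) (l₁ l₂ : Measure (ℝ × Simplex n)) : ℝ≥0∞ :=
  (⨅ (Γ : Measure ((ℝ × Simplex n) × (ℝ × Simplex n)))
    (_ : Γ.map Prod.fst = l₁) (_ : Γ.map Prod.snd = l₂),
    ∫⁻ z, groundSq θ q z.1 z.2 ∂Γ) ^ (1 / 2 : ℝ)

/-- The projection `𝔓`: the `i`-th component is the spatial marginal of `r_i dλ(x, r)`. -/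
def proj (l : Measure (ℝ × Simplex n)) : Fin n → Measure ℝ :=
  fun i => (l.withDensity (fun z => ENNReal.ofReal (z.2.1 i))).map Prod.fst

/-- The canonical lifting `λ_μ = ∑_j μ_j ⊗ δ_{e_j}`. -/
def canonicalLift (μ : Fin n → Measure ℝ) : Measure (ℝ × Simplex n) :=
  ∑ j, (μ j).prod (Measure.dirac (vertex j))

/-- The static semimetric `D_{ℝ × 𝒢}`. -/
def semiD (θ : ℝ → ℝ → ℝ) (q : Fin n → Fin n → ℝ) (μ ν : Fin n → Measure ℝ) : ℝ≥0∞ :=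
  ⨅ (l₁ : Measure (ℝ × Simplex n)) (l₂ : Measure (ℝ × Simplex n))
    (_ : IsProbabilityMeasure l₁) (_ : IsProbabilityMeasure l₂)
    (_ : proj l₁ = μ) (_ : proj l₂ = ν), liftW θ q l₁ l₂

/-- The static distance `W_{2,𝒲}`. -/
def staticW (θ : ℝ → ℝ → ℝ) (q : Fin n → Fin n → ℝ) (μ ν : Fin n → Measure ℝ) : ℝ≥0∞ :=
  liftW θ q (canonicalLift μ) (canonicalLift ν)

/-! ### Sharpness and strictness of an inequality `C · A ≤ B` on `𝒫₂(ℝ × 𝒢)` -/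

/-- Equality `C · A = B` is attained at a nontrivial pair (positive finite distance); in particular
`C` cannot be replaced by a larger constant. -/
def ConstantSharp (C : ℝ≥0∞) (A B : (Fin n → Measure ℝ) → (Fin n → Measure ℝ) → ℝ≥0∞) : Prop :=
  ∃ μ ν, IsVVProb₂ μ ∧ IsVVProb₂ ν ∧ 0 < B μ ν ∧ B μ ν < ⊤ ∧ C * A μ ν = B μ ν

/-- The strict inequality `C · A < B < ∞` occurs. -/
def StrictSomewhere (C : ℝ≥0∞) (A B : (Fin n → Measure ℝ) → (Fin n → Measure ℝ) → ℝ≥0∞) : Prop :=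
  ∃ μ ν, IsVVProb₂ μ ∧ IsVVProb₂ ν ∧ C * A μ ν < B μ ν ∧ B μ ν < ⊤

end VectorValued

end VVOT

end

/-! ### Cutoff functions and testing in time -/

namespace VVOT

/-! Take the arithmetic mean for θ. The densities of the two components add up to 1, so the mobility
of the edge is the constant 1/2, both on the simplex and almost everywhere for `total ρ`. The
actions become explicit quadratic forms: moving weight s along the edge costs at most 2s² in squared
distance, and the two vertices are exactly √2 apart. The general chain of inequalities is not
needed; everything is computed on measures ((1 - b)δ₀, bδ_a), always starting from (δ₀, 0).

Equality throughout: for (δ₀, 0) and (0, δ₀) all four distances equal √2 (`dBL_exchange`,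
`dynW_exchange`, `semiD_exchange`, `staticW_exchange`).

Strictness comes from three effects. The bounded Lipschitz distance is at most √8, whereas the
dynamic distance to (0, δ_a) exceeds this for a suitable distant a (`dBL_le`, `exists_lt_dynW`). If
the target components sit at different points, every lift must live on the vertices, so D² is at
least b(a² + 2) (`le_semiD_twoAtoms`); a dynamic curve can exchange mass as a mixed state at 0 and
separate the layers afterwards, with squared cost at most 2b²/τ + bc²(1 - τ), where a = c(1 - τ)
(`dynW_twoAtoms_le`). The exchange term is quadratic in b for the curve but linear in b for D.
Finally, when the components sit at the same point, D may use a barycentric lift, whereas the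
canonical lift of `staticW` is always pure (`semiD_exchange_half_le`, `le_staticW_twoAtoms`).

The triangle inequality fails for the same reason: passing through (δ₀/2, δ₀/2) permits a change of
lift at the midpoint, from the mixed one to the pure one, at no cost.

Lower bounds for actions come from testing the continuity equations with products φ(t)ψ(x) and
completing squares (`two_le_graphWSq_arith`, `VVContinuityEq.two_mul_sub_le`,
`VVContinuityEq.two_mul_total_sub_le`). -/

theorem ofReal_integral_le_lintegral {α : Type*} [MeasurableSpace α] (μ : Measure α) (f : α → ℝ) :
    ENNReal.ofReal (∫ x, f x ∂μ) ≤ ∫⁻ x, ENNReal.ofReal (f x) ∂μ := by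
  by_cases hf : Integrable f μ
  · calc ENNReal.ofReal (∫ x, f x ∂μ) ≤ ENNReal.ofReal (∫ x, max (f x) 0 ∂μ) :=
          ENNReal.ofReal_le_ofReal (integral_mono hf hf.pos_part fun x => le_max_left _ _)
      _ = ∫⁻ x, ENNReal.ofReal (max (f x) 0) ∂μ :=
          ofReal_integral_eq_lintegral_ofReal hf.pos_part
            (Filter.Eventually.of_forall fun x => le_max_right _ _)
      _ = ∫⁻ x, ENNReal.ofReal (f x) ∂μ := by
          refine lintegral_congr fun x => ?_
          rcases le_total (f x) 0 with h | h
          · rw [max_eq_right h, ENNReal.ofReal_zero, ENNReal.ofReal_of_nonpos h]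
          · rw [max_eq_left h]
  -- The Bochner integral is 0 by convention here. Thus no integrability or measurability is
  -- required, which matters for iterated integrals over time-dependent measures.
  · simp [integral_undef hf]

/-- Smooth cutoff functions in space with arbitrarily small slope. -/
theorem exists_space_cutoff {ε : ℝ} (hε : 0 < ε) :
    ∃ χ : ℝ → ℝ, ContDiff ℝ ∞ χ ∧ HasCompactSupport χ ∧ (∀ x, |χ x| ≤ 1) ∧ χ 0 = 1 ∧
      ∀ x, |deriv χ x| ≤ ε := by
  let f : ContDiffBump (0 : ℝ) := ⟨1, 2, one_pos, one_lt_two⟩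
  have hf : ContDiff ℝ ∞ f := f.contDiff
  obtain ⟨C, hC⟩ := (f.hasCompactSupport.deriv).exists_bound_of_continuous
    (hf.continuous_deriv (by simp))
  set k : ℝ := ε / (|C| + 1) with hk
  have hC0 : 0 < |C| + 1 := by positivity
  have hk0 : 0 < k := by positivity
  refine ⟨fun x => f (k * x), hf.comp (contDiff_const.mul contDiff_id), ?_, ?_, ?_, ?_⟩
  · exact f.hasCompactSupport.comp_homeomorph (Homeomorph.mulLeft₀ k hk0.ne')
  · intro x
    rw [abs_of_nonneg f.nonneg]
    exact f.le_one
  · simp only [mul_zero]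
    exact f.one_of_mem_closedBall (by simp [f])
  · intro x
    have hd : deriv (fun x => f (k * x)) x = k * deriv f (k * x) := by
      simpa using deriv_comp_mul_left k f x
    rw [hd, abs_mul, abs_of_pos hk0]
    have h1 : |deriv f (k * x)| ≤ |C| + 1 := by
      have := hC (k * x)
      rw [Real.norm_eq_abs] at this
      linarith [le_abs_self C]
    calc k * |deriv f (k * x)| ≤ k * (|C| + 1) := by gcongr
      _ = ε := by rw [hk]; field_simp

/-- On [a, b] the derivative of φ is a probability density carried by the times where g is ε-close
to c, so the integral is an average of such values. -/
theorem abs_integral_deriv_mul_sub_le {φ g : ℝ → ℝ} {a b c ε : ℝ} (hab : a ≤ b)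
    (hφ : ContDiff ℝ ∞ φ) (hg : ContinuousOn g (Icc a b))
    (hpos : ∀ t ∈ Icc a b, 0 ≤ deriv φ t)
    (hclose : ∀ t ∈ Icc a b, deriv φ t ≠ 0 → |g t - c| ≤ ε) (h1 : φ b - φ a = 1) :
    |(∫ t in a..b, deriv φ t * g t) - c| ≤ ε := by
  have hcont : Continuous (deriv φ) := hφ.continuous_deriv (by simp)
  have hint : ∫ t in a..b, deriv φ t = 1 := by
    rw [intervalIntegral.integral_deriv_eq_sub
      (fun x _ => (hφ.differentiable (by simp)).differentiableAt)
      (hcont.intervalIntegrable _ _), h1]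
  have hI : IntervalIntegrable (fun t => deriv φ t * g t) volume a b := by
    apply ContinuousOn.intervalIntegrable
    rw [uIcc_of_le hab]
    exact hcont.continuousOn.mul hg
  have e1 : (∫ t in a..b, deriv φ t * g t) - c = ∫ t in a..b, deriv φ t * (g t - c) := by
    simp_rw [mul_sub]
    rw [intervalIntegral.integral_sub hI ((hcont.intervalIntegrable _ _).mul_const c),
      intervalIntegral.integral_mul_const, hint, one_mul]
  rw [e1, ← Real.norm_eq_abs]
  calc ‖∫ t in a..b, deriv φ t * (g t - c)‖ ≤ ∫ t in a..b, deriv φ t * ε := by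
        refine intervalIntegral.norm_integral_le_of_norm_le hab ?_
          ((hcont.intervalIntegrable _ _).mul_const ε)
        refine Filter.Eventually.of_forall fun t ht => ?_
        have ht' : t ∈ Icc a b := Ioc_subset_Icc_self ht
        rw [norm_mul, Real.norm_eq_abs, Real.norm_eq_abs, abs_of_nonneg (hpos t ht')]
        by_cases h0 : deriv φ t = 0
        · simp [h0]
        · exact mul_le_mul_of_nonneg_left (hclose t ht' h0) (hpos t ht')
    _ = ε := by rw [intervalIntegral.integral_mul_const, hint, one_mul]

/-- Smooth functions compactly supported in `(0,1)` whose derivatives approximate `δ₀ - δ₁`. -/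
theorem exists_time_cutoff {ι : Type*} [Finite ι] (g : ι → ℝ → ℝ)
    (hg : ∀ i, ContinuousOn (g i) (Icc 0 1)) {ε : ℝ} (hε : 0 < ε) :
    ∃ φ : ℝ → ℝ, ContDiff ℝ ∞ φ ∧ HasCompactSupport φ ∧ tsupport φ ⊆ Ioo 0 1 ∧
      (∀ t, |φ t| ≤ 1) ∧
      ∀ i, |(∫ t in Icc (0 : ℝ) 1, deriv φ t * g i t) - (g i 0 - g i 1)| ≤ ε := by
  have h0 : ∀ᶠ t in nhdsWithin (0 : ℝ) (Icc 0 1), ∀ i, |g i t - g i 0| ≤ ε / 2 := by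
    rw [Filter.eventually_all]
    intro i
    have := (hg i 0 (by simp)).eventually (Metric.closedBall_mem_nhds (g i 0) (half_pos hε))
    simpa [Real.dist_eq] using this
  have h1 : ∀ᶠ t in nhdsWithin (1 : ℝ) (Icc 0 1), ∀ i, |g i t - g i 1| ≤ ε / 2 := by
    rw [Filter.eventually_all]
    intro i
    have := (hg i 1 (by simp)).eventually (Metric.closedBall_mem_nhds (g i 1) (half_pos hε))
    simpa [Real.dist_eq] using this
  obtain ⟨d₀, hd₀, H0⟩ := Metric.mem_nhdsWithin_iff.1 h0
  obtain ⟨d₁, hd₁, H1⟩ := Metric.mem_nhdsWithin_iff.1 h1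
  -- The cutoff rises on [δ, 2δ] and falls on [1 - 2δ, 1 - δ]. The bound 1/8 keeps both ramps away
  -- from (1/4, 3/4), so near each half of the interval only one factor varies.
  obtain ⟨δ, hδ, hδ8, hδ0, hδ1⟩ : ∃ δ : ℝ, 0 < δ ∧ δ ≤ 1 / 8 ∧ 2 * δ < d₀ ∧ 2 * δ < d₁ := by
    refine ⟨min (1 / 8) (min (d₀ / 3) (d₁ / 3)), by positivity, min_le_left _ _, ?_, ?_⟩
    · have : min (1 / 8) (min (d₀ / 3) (d₁ / 3)) ≤ d₀ / 3 :=
        (min_le_right _ _).trans (min_le_left _ _)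
      linarith
    · have : min (1 / 8) (min (d₀ / 3) (d₁ / 3)) ≤ d₁ / 3 :=
        (min_le_right _ _).trans (min_le_right _ _)
      linarith
  set S := Real.smoothTransition
  have hSmono : Monotone S := Real.smoothTransition.monotone
  have hScd : ContDiff ℝ ∞ S := Real.smoothTransition.contDiff
  let α : ℝ → ℝ := fun t => S (t / δ - 1)
  let β : ℝ → ℝ := fun t => S ((1 - t) / δ - 1)
  have hα : ContDiff ℝ ∞ α := hScd.comp (by fun_prop)
  have hβ : ContDiff ℝ ∞ β := hScd.comp (by fun_prop)
  have hαmono : Monotone α := fun s t hst => hSmono (by gcongr)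
  have hβanti : Antitone β := fun s t hst => hSmono (by gcongr)
  have hα1 : ∀ t, 2 * δ ≤ t → α t = 1 := fun t ht =>
    Real.smoothTransition.one_of_one_le (by
      have : 2 ≤ t / δ := (le_div_iff₀ hδ).2 ht
      linarith)
  have hβ1 : ∀ t, t ≤ 1 - 2 * δ → β t = 1 := fun t ht =>
    Real.smoothTransition.one_of_one_le (by
      have : 2 ≤ (1 - t) / δ := (le_div_iff₀ hδ).2 (by linarith)
      linarith)
  have hα0 : ∀ t, t ≤ δ → α t = 0 := fun t ht =>
    Real.smoothTransition.zero_of_nonpos (by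
      have : t / δ ≤ 1 := (div_le_iff₀ hδ).2 (by linarith)
      linarith)
  have hβ0 : ∀ t, 1 - δ ≤ t → β t = 0 := fun t ht =>
    Real.smoothTransition.zero_of_nonpos (by
      have : (1 - t) / δ ≤ 1 := (div_le_iff₀ hδ).2 (by linarith)
      linarith)
  let φ : ℝ → ℝ := fun t => α t * β t
  have hφ : ContDiff ℝ ∞ φ := hα.mul hβ
  have hsupp : tsupport φ ⊆ Icc δ (1 - δ) := by
    refine closure_minimal ?_ isClosed_Icc
    intro t ht
    by_contra hcon
    apply ht
    simp only [mem_Icc, not_and_or, not_le] at hcon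
    rcases hcon with h | h
    · simp [φ, hα0 t h.le]
    · simp [φ, hβ0 t h.le]
  have hdl : ∀ t, t ≤ 1 / 2 → deriv φ t = deriv α t := fun t ht => by
    apply Filter.EventuallyEq.deriv_eq
    filter_upwards [Iio_mem_nhds (show t < 3 / 4 by linarith)] with s hs
    have : β s = 1 := hβ1 s (by have := mem_Iio.1 hs; linarith)
    simp [φ, this]
  have hdr : ∀ t, 1 / 2 ≤ t → deriv φ t = deriv β t := fun t ht => by
    apply Filter.EventuallyEq.deriv_eq
    filter_upwards [Ioi_mem_nhds (show 1 / 4 < t by linarith)] with s hs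
    have : α s = 1 := hα1 s (by have := mem_Ioi.1 hs; linarith)
    simp [φ, this]
  refine ⟨φ, hφ, ?_, hsupp.trans fun t ht => ⟨by linarith [ht.1], by linarith [ht.2]⟩, ?_, ?_⟩
  · exact HasCompactSupport.of_support_subset_isCompact isCompact_Icc
      ((subset_tsupport φ).trans hsupp)
  · intro t
    have a0 : 0 ≤ α t := Real.smoothTransition.nonneg _
    have a1 : α t ≤ 1 := Real.smoothTransition.le_one _
    have b0 : 0 ≤ β t := Real.smoothTransition.nonneg _
    have b1 : β t ≤ 1 := Real.smoothTransition.le_one _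
    rw [abs_of_nonneg (mul_nonneg a0 b0)]
    exact mul_le_one₀ a1 b0 b1
  · intro i
    have hcont : Continuous (deriv φ) := hφ.continuous_deriv (by simp)
    have hg0 : ContinuousOn (g i) (Icc 0 (1 / 2)) :=
      (hg i).mono (Icc_subset_Icc le_rfl (by norm_num))
    have hg1 : ContinuousOn (g i) (Icc (1 / 2) 1) :=
      (hg i).mono (Icc_subset_Icc (by norm_num) le_rfl)
    have hI0 : IntervalIntegrable (fun t => deriv φ t * g i t) volume 0 (1 / 2) := by
      apply ContinuousOn.intervalIntegrable
      rw [uIcc_of_le (by norm_num)]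
      exact hcont.continuousOn.mul hg0
    have hI1 : IntervalIntegrable (fun t => deriv φ t * g i t) volume (1 / 2) 1 := by
      apply ContinuousOn.intervalIntegrable
      rw [uIcc_of_le (by norm_num)]
      exact hcont.continuousOn.mul hg1
    have E0 : |(∫ t in (0 : ℝ)..(1 / 2), deriv φ t * g i t) - g i 0| ≤ ε / 2 := by
      refine abs_integral_deriv_mul_sub_le (by norm_num) hφ hg0 ?_ ?_ ?_
      · intro t ht
        rw [hdl t ht.2]
        exact hαmono.deriv_nonneg
      · intro t ht hne
        have ht2 : t ≤ 2 * δ := by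
          by_contra hcon
          apply hne
          rw [hdl t ht.2]
          have : α =ᶠ[nhds t] fun _ => 1 := by
            filter_upwards [Ioi_mem_nhds (not_le.1 hcon)] with s hs
            exact hα1 s (mem_Ioi.1 hs).le
          rw [this.deriv_eq, deriv_const]
        refine H0 ⟨?_, ht.1, by linarith [ht.2]⟩ i
        rw [Metric.mem_ball, Real.dist_eq, sub_zero, abs_of_nonneg ht.1]
        linarith
      · simp only [φ]
        rw [hα0 0 hδ.le, hα1 (1 / 2) (by linarith), hβ1 (1 / 2) (by linarith)]
        norm_num
    -- On the right half φ decreases, so -φ has the nonnegative derivative of total integral 1.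
    have E1 : |(∫ t in (1 / 2 : ℝ)..1, deriv (fun t => -φ t) t * g i t) - g i 1| ≤ ε / 2 := by
      have hdn : ∀ t, deriv (fun t => -φ t) t = -deriv φ t := fun t => deriv.fun_neg
      refine abs_integral_deriv_mul_sub_le (by norm_num) hφ.neg hg1 ?_ ?_ ?_
      · intro t ht
        rw [hdn, hdr t ht.1]
        have := hβanti.deriv_nonpos (x := t)
        linarith
      · intro t ht hne
        have ht2 : 1 - 2 * δ ≤ t := by
          by_contra hcon
          apply hne
          rw [hdn, hdr t ht.1]
          have : β =ᶠ[nhds t] fun _ => 1 := by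
            filter_upwards [Iio_mem_nhds (not_le.1 hcon)] with s hs
            exact hβ1 s (mem_Iio.1 hs).le
          rw [this.deriv_eq, deriv_const, neg_zero]
        refine H1 ⟨?_, by linarith [ht.1], ht.2⟩ i
        rw [Metric.mem_ball, Real.dist_eq, abs_of_nonpos (by linarith [ht.2])]
        linarith
      · simp only [φ]
        rw [hβ0 1 (by linarith), hα1 (1 / 2) (by linarith), hβ1 (1 / 2) (by linarith)]
        norm_num
    have E1' : |(∫ t in (1 / 2 : ℝ)..1, deriv φ t * g i t) + g i 1| ≤ ε / 2 := by
      have : (∫ t in (1 / 2 : ℝ)..1, deriv (fun t => -φ t) t * g i t)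
          = -∫ t in (1 / 2 : ℝ)..1, deriv φ t * g i t := by
        rw [← intervalIntegral.integral_neg]
        congr 1
        ext t
        rw [deriv.fun_neg, neg_mul]
      rw [this, ← abs_neg] at E1
      convert E1 using 2
      ring
    rw [integral_Icc_eq_integral_Ioc, ← intervalIntegral.integral_of_le zero_le_one,
      ← intervalIntegral.integral_add_adjacent_intervals hI0 hI1]
    rw [abs_le] at *
    constructor <;> linarith [E0.1, E0.2, E1'.1, E1'.2]

/-! ### The arithmetic mean and the distance on the simplex -/

/-- The arithmetic mean as interpolation function. -/
noncomputable def arith (s t : ℝ) : ℝ := (s + t) / 2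

theorem isInterpolation_arith : IsInterpolation arith where
  nonneg s t hs ht := by unfold arith; positivity
  continuousOn := by unfold arith; fun_prop
  smooth := by unfold arith; fun_prop
  symm s t _ _ := by unfold arith; ring
  pos s t hs ht := by unfold arith; positivity
  normalized := by norm_num [arith]
  mono r s t _ h _ := by unfold arith; gcongr
  homogeneous c s t _ _ _ := by unfold arith; ring
  concave := by
    refine ⟨(convex_Ici 0).prod (convex_Ici 0), fun x _ y _ a b _ _ _ => ?_⟩
    simp only [arith, smul_eq_mul, Prod.fst_add, Prod.smul_fst, Prod.snd_add, Prod.smul_snd]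
    apply le_of_eq
    ring

/-- Both orientations of the edge have mobility (p₀ + p₁)/2 = 1/2, so the tangent norm does not
depend on p. -/
theorem graphTanNormSq_arith {p : Fin 2 → ℝ} (hp : p ∈ stdSimplex ℝ (Fin 2))
    (v : Fin 2 → Fin 2 → ℝ) :
    graphTanNormSq arith twoNode p v = (v 0 1 ^ 2 + v 1 0 ^ 2) / 4 := by
  have h : p 0 + p 1 = 1 := by simpa [Fin.sum_univ_two] using hp.2
  have h' : p 1 + p 0 = 1 := by rw [add_comm, h]
  simp [graphTanNormSq, Fin.sum_univ_two, twoNode, arith, h, h']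
  ring

theorem zero_of_tsupport_subset {φ : ℝ → ℝ} (h : tsupport φ ⊆ Ioo 0 1) : φ 0 = 0 ∧ φ 1 = 0 :=
  ⟨image_eq_zero_of_notMem_tsupport fun h0 => by simpa using h h0,
    image_eq_zero_of_notMem_tsupport fun h0 => by simpa using h h0⟩

/-- Upper bound on the graph distance by the straight line. -/
theorem graphWSq_arith_le {p q : Fin 2 → ℝ} (hp : p ∈ stdSimplex ℝ (Fin 2))
    (hq : q ∈ stdSimplex ℝ (Fin 2)) :
    graphWSq arith twoNode p q ≤ ENNReal.ofReal (2 * (p 0 - q 0) ^ 2) := by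
  have hp1 : p 0 + p 1 = 1 := by simpa [Fin.sum_univ_two] using hp.2
  have hq1 : q 0 + q 1 = 1 := by simpa [Fin.sum_univ_two] using hq.2
  let P : ℝ → Fin 2 → ℝ := fun t => (1 - t) • p + t • q
  -- The constant antisymmetric velocity: with mobility 1/2, the rate of p₀ is (v₀₁ - v₁₀)/4, which
  -- is q₀ - p₀ for this choice.
  let v : ℝ → Fin 2 → Fin 2 → ℝ := fun _ => ![![0, 2 * (q 0 - p 0)], ![2 * (q 1 - p 1), 0]]
  have hP : ∀ t ∈ Icc (0 : ℝ) 1, P t ∈ stdSimplex ℝ (Fin 2) := fun t ht =>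
    convex_stdSimplex ℝ (Fin 2) hp hq (by linarith [ht.2]) ht.1 (by ring)
  have hPc : Continuous P := by fun_prop
  have hPs : ∀ t, P t 0 + P t 1 = 1 := fun t => by
    simp only [P, Pi.add_apply, Pi.smul_apply, smul_eq_mul]
    linear_combination (1 - t) * hp1 + t * hq1
  have hsol : GraphContinuityEq arith twoNode P v := by
    refine ⟨hP, hPc.continuousOn, measurable_const, fun i j => ?_, fun φ hφ hc hs i => ?_⟩
    · refine (Continuous.locallyIntegrable ?_).locallyIntegrableOn _
      unfold arith
      fun_prop
    · obtain ⟨h0, h1⟩ := zero_of_tsupport_subset hs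
      have hder : ∀ t, -(1 / 2) * ∑ j, (arith (P t i) (P t j) * v t i j
          - arith (P t j) (P t i) * v t j i) * twoNode i j = -(q i - p i) := by
        intro t
        have h' : P t 1 + P t 0 = 1 := by rw [add_comm, hPs t]
        fin_cases i
        · simp [Fin.sum_univ_two, twoNode, arith, hPs t, h', v]
          linarith
        · simp [Fin.sum_univ_two, twoNode, arith, hPs t, h', v]
          linarith
      simp_rw [hder]
      have hPd : ∀ t, HasDerivAt (fun t => P t i) (q i - p i) t := fun t => by
        simp only [P, Pi.add_apply, Pi.smul_apply, smul_eq_mul]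
        have := (((hasDerivAt_id t).const_sub 1).mul_const (p i)).add
          ((hasDerivAt_id t).mul_const (q i))
        exact this.congr_deriv (by ring)
      have hφd : ∀ t, HasDerivAt φ (deriv φ t) t := fun t =>
        ((hφ.differentiable (by simp)) t).hasDerivAt
      have hφc : Continuous (deriv φ) := hφ.continuous_deriv (by simp)
      have := intervalIntegral.integral_deriv_mul_eq_sub (a := 0) (b := 1)
        (fun t _ => hφd t) (fun t _ => hPd t) (hφc.intervalIntegrable _ _)
        (continuous_const.intervalIntegrable _ _)
      have hI : IntervalIntegrable (fun t => deriv φ t * P t i) volume 0 1 :=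
        (hφc.mul (by fun_prop)).intervalIntegrable _ _
      have hJ : IntervalIntegrable (fun t => φ t * (q i - p i)) volume 0 1 :=
        (hφ.continuous.mul continuous_const).intervalIntegrable _ _
      rw [h0, h1, zero_mul, zero_mul, sub_zero, intervalIntegral.integral_add hI hJ] at this
      simp only [mul_neg, integral_neg]
      rw [integral_Icc_eq_integral_Ioc, integral_Icc_eq_integral_Ioc,
        ← intervalIntegral.integral_of_le zero_le_one,
        ← intervalIntegral.integral_of_le zero_le_one]
      linarith
  refine iInf_le_of_le P (iInf_le_of_le v (iInf_le_of_le hsol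
    (iInf_le_of_le (by simp [P]) (iInf_le_of_le (by simp [P]) ?_))))
  calc ∫⁻ t in Icc (0 : ℝ) 1, ENNReal.ofReal (graphTanNormSq arith twoNode (P t) (v t))
      ≤ ∫⁻ t in Icc (0 : ℝ) 1, ENNReal.ofReal (2 * (p 0 - q 0) ^ 2) := by
        refine setLIntegral_mono measurable_const fun t ht => ?_
        rw [graphTanNormSq_arith (hP t ht)]
        apply le_of_eq
        congr 1
        have : q 1 - p 1 = p 0 - q 0 := by linarith
        simp [v, this]
        ring
    _ = ENNReal.ofReal (2 * (p 0 - q 0) ^ 2) := by simp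

/-- The two vertices are at squared distance at least `2`. -/
theorem two_le_graphWSq_arith {p q : Fin 2 → ℝ} (hp : p 0 = 1) (hq : q 0 = 0) :
    2 ≤ graphWSq arith twoNode p q := by
  refine le_iInf fun P => le_iInf fun v => le_iInf fun hs => le_iInf fun h0 => le_iInf fun h1 => ?_
  set E := ∫⁻ t in Icc (0 : ℝ) 1, ENNReal.ofReal (graphTanNormSq arith twoNode (P t) (v t))
    with hE
  by_cases hEt : E = ⊤
  · simp [hEt]
  have key : ∀ ε : ℝ, 0 < ε → 4 ≤ 4 * ε + (2 + E.toReal) := by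
    intro ε hε
    obtain ⟨φ, hφ, hc, hsu, hb, hg⟩ := exists_time_cutoff (fun _ : Unit => fun t => P t 0)
      (fun _ => (continuous_apply 0).comp_continuousOn hs.continuousOn) hε
    have hg' := (abs_le.1 (hg ())).1
    rw [hs.equation φ hφ hc hsu 0, h0, h1, hp, hq] at hg'
    have hint : ∫ t in Icc (0 : ℝ) 1, φ t * (-(1 / 2) * ∑ j,
        (arith (P t 0) (P t j) * v t 0 j - arith (P t j) (P t 0) * v t j 0) * twoNode 0 j)
        = 1 / 4 * ∫ t in Icc (0 : ℝ) 1, φ t * (v t 1 0 - v t 0 1) := by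
      rw [← integral_const_mul]
      refine setIntegral_congr_fun measurableSet_Icc fun t ht => ?_
      have h : P t 0 + P t 1 = 1 := by simpa [Fin.sum_univ_two] using (hs.mem_simplex t ht).2
      have h' : P t 1 + P t 0 = 1 := by rw [add_comm, h]
      simp [Fin.sum_univ_two, twoNode, arith, h, h']
      ring
    rw [hint] at hg'
    have hle : ENNReal.ofReal (∫ t in Icc (0 : ℝ) 1, φ t * (v t 1 0 - v t 0 1)) ≤ 2 + E := by
      calc _ ≤ ∫⁻ t in Icc (0 : ℝ) 1, ENNReal.ofReal (φ t * (v t 1 0 - v t 0 1)) :=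
            ofReal_integral_le_lintegral _ _
        _ ≤ ∫⁻ t in Icc (0 : ℝ) 1,
            (2 + ENNReal.ofReal (graphTanNormSq arith twoNode (P t) (v t))) := by
          refine setLIntegral_mono' measurableSet_Icc fun t ht => ?_
          rw [graphTanNormSq_arith (hs.mem_simplex t ht),
            show (2 : ℝ≥0∞) = ENNReal.ofReal 2 by simp,
            ← ENNReal.ofReal_add (by norm_num) (by positivity)]
          apply ENNReal.ofReal_le_ofReal
          -- Completing squares at v₁₀ = 2φ, v₀₁ = -2φ, the velocity of the straight line between
          -- the vertices when φ = 1, so the bound is sharp.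
          have hφt := abs_le.1 (hb t)
          have hφ2 : φ t ^ 2 ≤ 1 := by nlinarith
          nlinarith [sq_nonneg (v t 1 0 - 2 * φ t), sq_nonneg (v t 0 1 + 2 * φ t)]
        _ = 2 + E := by
          rw [lintegral_add_left measurable_const]
          simp [hE]
    have h3 : (∫ t in Icc (0 : ℝ) 1, φ t * (v t 1 0 - v t 0 1)) ≤ 2 + E.toReal := by
      have := (ENNReal.ofReal_le_iff_le_toReal (by simp [hEt])).1 hle
      rwa [ENNReal.toReal_add (by simp) hEt, ENNReal.toReal_ofNat] at this
    linarith
  have h2 : 2 ≤ E.toReal := by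
    refine le_of_forall_pos_le_add fun ε hε => ?_
    have := key (ε / 4) (by positivity)
    linarith
  rw [← ENNReal.ofReal_toReal hEt, show (2 : ℝ≥0∞) = ENNReal.ofReal 2 by simp]
  exact ENNReal.ofReal_le_ofReal h2

/-! ### Two-atom measures, their lifts and upper bounds -/

/-- The vector measure `((1 - b) δ₀, b δ_a)`. -/
noncomputable def twoAtoms (a b : ℝ) : Fin 2 → Measure ℝ :=
  ![ENNReal.ofReal (1 - b) • Measure.dirac 0, ENNReal.ofReal b • Measure.dirac a]

/-- The mixture `(1 - b) δ_{z₀} + b δ_{z₁}`. -/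
noncomputable def mix {α : Type*} [MeasurableSpace α] (b : ℝ) (z₀ z₁ : α) : Measure α :=
  ENNReal.ofReal (1 - b) • Measure.dirac z₀ + ENNReal.ofReal b • Measure.dirac z₁

theorem ofReal_one_sub_add {b : ℝ} (h0 : 0 ≤ b) (h1 : b ≤ 1) :
    ENNReal.ofReal (1 - b) + ENNReal.ofReal b = 1 := by
  rw [← ENNReal.ofReal_add (by linarith) h0]
  simp

theorem isProbabilityMeasure_mix {α : Type*} [MeasurableSpace α] {b : ℝ} (h0 : 0 ≤ b)
    (h1 : b ≤ 1) (z₀ z₁ : α) : IsProbabilityMeasure (mix b z₀ z₁) :=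
  ⟨by simp [mix, ofReal_one_sub_add h0 h1]⟩

theorem mix_self {α : Type*} [MeasurableSpace α] {b : ℝ} (h0 : 0 ≤ b) (h1 : b ≤ 1) (z : α) :
    mix b z z = Measure.dirac z := by
  rw [mix, ← add_smul, ofReal_one_sub_add h0 h1, one_smul]

theorem map_mix {α β : Type*} [MeasurableSpace α] [MeasurableSpace β] {f : α → β}
    (hf : Measurable f) (b : ℝ) (z₀ z₁ : α) : (mix b z₀ z₁).map f = mix b (f z₀) (f z₁) := by
  simp [mix, Measure.map_add _ _ hf, Measure.map_smul, Measure.map_dirac' hf]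

theorem lintegral_mix {α : Type*} [MeasurableSpace α] [MeasurableSingletonClass α] (b : ℝ)
    (z₀ z₁ : α) (f : α → ℝ≥0∞) :
    ∫⁻ z, f z ∂(mix b z₀ z₁) = ENNReal.ofReal (1 - b) * f z₀ + ENNReal.ofReal b * f z₁ := by
  simp [mix, lintegral_add_measure, lintegral_smul_measure]

/-- The coupling matches atoms of equal index, possible because both mixtures have the same weights.
-/
theorem liftW_mix_le (θ : ℝ → ℝ → ℝ) (q : Fin 2 → Fin 2 → ℝ) (b : ℝ)
    (z₀ z₁ w₀ w₁ : ℝ × Simplex 2) :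
    liftW θ q (mix b z₀ z₁) (mix b w₀ w₁) ≤
      (ENNReal.ofReal (1 - b) * groundSq θ q z₀ w₀ +
        ENNReal.ofReal b * groundSq θ q z₁ w₁) ^ (1 / 2 : ℝ) := by
  refine ENNReal.rpow_le_rpow ?_ (by norm_num)
  refine iInf_le_of_le (mix b (z₀, w₀) (z₁, w₁)) (iInf_le_of_le (map_mix measurable_fst _ _ _)
    (iInf_le_of_le (map_mix measurable_snd _ _ _) ?_))
  rw [lintegral_mix]

theorem measurable_weight (i : Fin 2) :
    Measurable fun z : ℝ × Simplex 2 => ENNReal.ofReal (z.2.1 i) :=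
  ((measurable_pi_apply i).comp (measurable_subtype_coe.comp measurable_snd)).ennreal_ofReal

theorem proj_mix (b : ℝ) (z₀ z₁ : ℝ × Simplex 2) (i : Fin 2) :
    proj (mix b z₀ z₁) i =
      (ENNReal.ofReal (1 - b) * ENNReal.ofReal (z₀.2.1 i)) • Measure.dirac z₀.1 +
        (ENNReal.ofReal b * ENNReal.ofReal (z₁.2.1 i)) • Measure.dirac z₁.1 := by
  ext s hs
  have hs' : MeasurableSet (Prod.fst ⁻¹' s : Set (ℝ × Simplex 2)) := measurable_fst hs
  rw [proj, Measure.map_apply measurable_fst hs, withDensity_apply _ hs', ← lintegral_indicator hs',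
    lintegral_mix]
  simp only [indicator, mem_preimage, Measure.add_apply, Measure.smul_apply,
    Measure.dirac_apply' _ hs, smul_eq_mul]
  split_ifs <;> simp_all

theorem canonicalLift_twoAtoms (a b : ℝ) :
    canonicalLift (twoAtoms a b) = mix b ((0 : ℝ), vertex (0 : Fin 2)) (a, vertex 1) := by
  simp [canonicalLift, twoAtoms, mix, Fin.sum_univ_two, Measure.prod_smul_left,
    Measure.dirac_prod_dirac]

theorem proj_canonicalLift_twoAtoms (a b : ℝ) :
    proj (canonicalLift (twoAtoms a b)) = twoAtoms a b := by
  rw [canonicalLift_twoAtoms]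
  funext i
  rw [proj_mix]
  fin_cases i <;> simp [vertex, twoAtoms]

theorem isVVProb₂_twoAtoms (a : ℝ) {b : ℝ} (h0 : 0 ≤ b) (h1 : b ≤ 1) :
    IsVVProb₂ (twoAtoms a b) := by
  refine ⟨by simp [IsVVProb, Fin.sum_univ_two, twoAtoms, ofReal_one_sub_add h0 h1], fun i => ?_⟩
  fin_cases i
  · simp [twoAtoms]
  · simp [twoAtoms, ENNReal.mul_lt_top]

theorem semiD_le_liftW {θ : ℝ → ℝ → ℝ} {q : Fin 2 → Fin 2 → ℝ} {μ ν : Fin 2 → Measure ℝ}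
    {l₁ l₂ : Measure (ℝ × Simplex 2)} (h₁ : IsProbabilityMeasure l₁)
    (h₂ : IsProbabilityMeasure l₂) (hμ : proj l₁ = μ) (hν : proj l₂ = ν) :
    semiD θ q μ ν ≤ liftW θ q l₁ l₂ :=
  iInf_le_of_le l₁ (iInf_le_of_le l₂ (iInf_le_of_le h₁ (iInf_le_of_le h₂
    (iInf_le_of_le hμ (iInf_le _ hν)))))

theorem semiD_twoAtoms_le_staticW (θ : ℝ → ℝ → ℝ) (q : Fin 2 → Fin 2 → ℝ) (a a' : ℝ) {b b' : ℝ}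
    (h0 : 0 ≤ b) (h1 : b ≤ 1) (h0' : 0 ≤ b') (h1' : b' ≤ 1) :
    semiD θ q (twoAtoms a b) (twoAtoms a' b') ≤ staticW θ q (twoAtoms a b) (twoAtoms a' b') := by
  refine semiD_le_liftW ?_ ?_ (proj_canonicalLift_twoAtoms a b) (proj_canonicalLift_twoAtoms a' b')
  · rw [canonicalLift_twoAtoms]
    exact isProbabilityMeasure_mix h0 h1 _ _
  · rw [canonicalLift_twoAtoms]
    exact isProbabilityMeasure_mix h0' h1' _ _

/-- Splitting the single atom into two coinciding ones gives it the weights of any other mixture, so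
that `liftW_mix_le` applies. -/
theorem canonicalLift_twoAtoms_zero {b : ℝ} (h0 : 0 ≤ b) (h1 : b ≤ 1) :
    canonicalLift (twoAtoms 0 0) =
      mix b ((0 : ℝ), vertex (0 : Fin 2)) ((0 : ℝ), vertex (0 : Fin 2)) := by
  rw [canonicalLift_twoAtoms, mix_self h0 h1]
  simp [mix]

theorem groundSq_arith_le (z w : ℝ × Simplex 2) :
    groundSq arith twoNode z w ≤
      ENNReal.ofReal ((z.1 - w.1) ^ 2 + 2 * (z.2.1 0 - w.2.1 0) ^ 2) := by
  rw [groundSq, ENNReal.ofReal_add (by positivity) (by positivity)]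
  gcongr
  exact graphWSq_arith_le z.2.2 w.2.2

theorem liftW_mix_arith_le {b : ℝ} (h0 : 0 ≤ b) (h1 : b ≤ 1) (z₀ z₁ w₀ w₁ : ℝ × Simplex 2) :
    liftW arith twoNode (mix b z₀ z₁) (mix b w₀ w₁) ≤
      (ENNReal.ofReal ((1 - b) * ((z₀.1 - w₀.1) ^ 2 + 2 * (z₀.2.1 0 - w₀.2.1 0) ^ 2) +
        b * ((z₁.1 - w₁.1) ^ 2 + 2 * (z₁.2.1 0 - w₁.2.1 0) ^ 2))) ^ (1 / 2 : ℝ) := by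
  refine (liftW_mix_le _ _ _ _ _ _ _).trans (ENNReal.rpow_le_rpow ?_ (by norm_num))
  have h1' : 0 ≤ 1 - b := by linarith
  rw [ENNReal.ofReal_add (by positivity) (by positivity), ENNReal.ofReal_mul h1',
    ENNReal.ofReal_mul h0]
  gcongr <;> exact groundSq_arith_le _ _

theorem staticW_twoAtoms_le (a : ℝ) {b : ℝ} (h0 : 0 ≤ b) (h1 : b ≤ 1) :
    staticW arith twoNode (twoAtoms 0 0) (twoAtoms a b) ≤
      ENNReal.ofReal (b * (a ^ 2 + 2)) ^ (1 / 2 : ℝ) := by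
  rw [staticW, canonicalLift_twoAtoms_zero h0 h1, canonicalLift_twoAtoms]
  refine (liftW_mix_arith_le h0 h1 _ _ _ _).trans_eq ?_
  simp [vertex]

/-- Exchanging half of the mass at a fixed position, through barycentric lifts. -/
theorem semiD_exchange_half_le :
    semiD arith twoNode (twoAtoms 0 0) (twoAtoms 0 (1 / 2)) ≤
      ENNReal.ofReal (1 / 2) ^ (1 / 2 : ℝ) := by
  let h : Simplex 2 := ⟨fun _ => 1 / 2, fun _ => by norm_num, by norm_num [Fin.sum_univ_two]⟩
  have hb0 : (0 : ℝ) ≤ 1 / 2 := by norm_num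
  have hb1 : (1 / 2 : ℝ) ≤ 1 := by norm_num
  -- All the mass moves from the vertex to the barycentre at squared cost 2(1/2)² = 1/2, instead of
  -- half the mass moving to the other vertex at cost 2.
  refine (semiD_le_liftW (l₁ := mix (1 / 2) ((0 : ℝ), vertex (0 : Fin 2)) (0, vertex 0))
    (l₂ := mix (1 / 2) (0, h) (0, h)) (isProbabilityMeasure_mix hb0 hb1 _ _)
    (isProbabilityMeasure_mix hb0 hb1 _ _) ?_ ?_).trans
    ((liftW_mix_arith_le hb0 hb1 _ _ _ _).trans_eq ?_)
  · rw [← canonicalLift_twoAtoms_zero hb0 hb1, proj_canonicalLift_twoAtoms]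
  · rw [mix_self hb0 hb1, ← mix_self le_rfl zero_le_one]
    funext i
    rw [proj_mix]
    fin_cases i <;> norm_num [twoAtoms, h]
  · simp only [vertex, h, Pi.single_eq_same]
    norm_num

theorem semiD_translate_half_le (a : ℝ) :
    semiD arith twoNode (twoAtoms 0 (1 / 2)) (twoAtoms a (1 / 2)) ≤
      ENNReal.ofReal (a ^ 2 / 2) ^ (1 / 2 : ℝ) := by
  have hb0 : (0 : ℝ) ≤ 1 / 2 := by norm_num
  have hb1 : (1 / 2 : ℝ) ≤ 1 := by norm_num
  refine (semiD_twoAtoms_le_staticW _ _ _ _ hb0 hb1 hb0 hb1).trans ?_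
  rw [staticW, canonicalLift_twoAtoms, canonicalLift_twoAtoms]
  refine (liftW_mix_arith_le hb0 hb1 _ _ _ _).trans_eq ?_
  rw [show a ^ 2 / 2 = (1 / 2) * a ^ 2 by ring]
  simp [vertex]

/-! ### Lower bounds for the static distances -/

/-- A vanishing integral of the nonnegative weight forces the weight to vanish almost everywhere
over s. This is how the projected measures constrain their lifts. -/
theorem ae_notMem_of_proj {l : Measure (ℝ × Simplex 2)} {i : Fin 2} {s : Set ℝ}
    (hs : MeasurableSet s) (h : proj l i s = 0) : ∀ᵐ w ∂l, 0 < w.2.1 i → w.1 ∉ s := by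
  rw [proj, Measure.map_apply measurable_fst hs,
    withDensity_apply_eq_zero (measurable_weight i)] at h
  rw [ae_iff]
  refine measure_mono_null (fun w hw => ?_) h
  simpa using hw

theorem lintegral_weight (l : Measure (ℝ × Simplex 2)) (i : Fin 2) :
    ∫⁻ w, ENNReal.ofReal (w.2.1 i) ∂l = proj l i univ := by
  rw [proj, Measure.map_apply measurable_fst .univ, preimage_univ, withDensity_apply _ .univ,
    Measure.restrict_univ]

theorem simplex_add (p : Simplex 2) : p.1 0 + p.1 1 = 1 := by
  simpa [Fin.sum_univ_two] using p.2.2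

/-- If the second components of a lift only charge pure states at `a`, all this mass has to be
created at `0` and transported to `a`. -/
theorem le_liftW {l₁ l₂ : Measure (ℝ × Simplex 2)} {a b : ℝ}
    (h₁ : proj l₁ = twoAtoms 0 0) (h₂ : proj l₂ = twoAtoms a b)
    (h : ∀ᵐ w ∂l₂, 0 < w.2.1 1 → w.1 = a ∧ w.2.1 0 = 0) :
    ENNReal.ofReal (b * (a ^ 2 + 2)) ^ (1 / 2 : ℝ) ≤ liftW arith twoNode l₁ l₂ := by
  refine ENNReal.rpow_le_rpow ?_ (by norm_num)
  refine le_iInf fun Γ => le_iInf fun hΓ₁ => le_iInf fun hΓ₂ => ?_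
  have a1 : ∀ᵐ z ∂Γ, z.1.1 = 0 ∧ z.1.2.1 0 = 1 := by
    have A : ∀ᵐ w ∂l₁, w.1 = 0 ∧ w.2.1 0 = 1 := by
      have e1 := ae_notMem_of_proj (l := l₁) (i := 1) .univ (by simp [h₁, twoAtoms])
      have e0 := ae_notMem_of_proj (l := l₁) (i := 0) (measurableSet_singleton (0 : ℝ)).compl
        (by simp [h₁, twoAtoms])
      filter_upwards [e1, e0] with w hw1 hw0
      have hw2 : w.2.1 1 = 0 := le_antisymm (by simpa using hw1) (w.2.2.1 1)
      have hw3 : w.2.1 0 = 1 := by linarith [simplex_add w.2]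
      exact ⟨by simpa using hw0 (by rw [hw3]; exact one_pos), hw3⟩
    rw [← hΓ₁] at A
    exact ae_of_ae_map measurable_fst.aemeasurable A
  have a2 : ∀ᵐ z ∂Γ, 0 < z.2.2.1 1 → z.2.1 = a ∧ z.2.2.1 0 = 0 := by
    rw [← hΓ₂] at h
    exact ae_of_ae_map measurable_snd.aemeasurable h
  have hmass : ∫⁻ z, ENNReal.ofReal (z.2.2.1 1) ∂Γ = ENNReal.ofReal b := by
    rw [← lintegral_map (f := fun w : ℝ × Simplex 2 => ENNReal.ofReal (w.2.1 1))
      (measurable_weight 1) measurable_snd, hΓ₂, lintegral_weight, h₂]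
    simp [twoAtoms]
  calc ENNReal.ofReal (b * (a ^ 2 + 2))
      = ∫⁻ z, ENNReal.ofReal (z.2.2.1 1) * ENNReal.ofReal (a ^ 2 + 2) ∂Γ := by
        have hm : Measurable fun z : (ℝ × Simplex 2) × (ℝ × Simplex 2) =>
          ENNReal.ofReal (z.2.2.1 1) := (measurable_weight 1).comp measurable_snd
        rw [lintegral_mul_const _ hm, hmass,
          ← ENNReal.ofReal_mul' (by positivity)]
    _ ≤ ∫⁻ z, groundSq arith twoNode z.1 z.2 ∂Γ := by
        refine lintegral_mono_ae ?_
        filter_upwards [a1, a2] with z hz1 hz2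
        -- The second weight of the target state is 0 or 1 almost everywhere: in the first case the
        -- bound is trivial, in the second the full cost a² + 2 is paid.
        rcases (z.2.2.2.1 1).eq_or_lt with h0 | h0
        · change 0 = z.2.2.1 1 at h0
          rw [← h0]
          simp
        · obtain ⟨ha, hp⟩ := hz2 h0
          have hp1 : z.2.2.1 1 = 1 := by linarith [simplex_add z.2.2]
          rw [hp1, groundSq, hz1.1, ha, ENNReal.ofReal_add (by positivity) (by norm_num)]
          simp only [ENNReal.ofReal_one, one_mul, zero_sub, even_two, Even.neg_pow]
          gcongr
          simpa using two_le_graphWSq_arith hz1.2 hp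

/-- A state with both weights positive would have to lie over 0 and over a at once, which a ≠ 0
excludes; if b = 1 the first component is zero and no state may charge it. Every lift of the target
is therefore pure. -/
theorem le_semiD_twoAtoms {a b : ℝ} (hab : a ≠ 0 ∨ b = 1) :
    ENNReal.ofReal (b * (a ^ 2 + 2)) ^ (1 / 2 : ℝ) ≤
      semiD arith twoNode (twoAtoms 0 0) (twoAtoms a b) := by
  refine le_iInf fun l₁ => le_iInf fun l₂ => le_iInf fun _ => le_iInf fun _ => le_iInf fun h₁ =>
    le_iInf fun h₂ => le_liftW h₁ h₂ ?_
  have e1 := ae_notMem_of_proj (l := l₂) (i := 1) (measurableSet_singleton a).compl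
    (by simp [h₂, twoAtoms])
  have e0 : ∀ᵐ w ∂l₂, 0 < w.2.1 0 → w.1 = 0 ∧ b ≠ 1 := by
    have e := ae_notMem_of_proj (l := l₂) (i := 0) (measurableSet_singleton (0 : ℝ)).compl
      (by simp [h₂, twoAtoms])
    rcases eq_or_ne b 1 with hb | hb
    · filter_upwards [ae_notMem_of_proj (l := l₂) (i := 0) .univ (by simp [h₂, twoAtoms, hb])]
        with w hw h
      exact absurd (mem_univ _) (hw h)
    · filter_upwards [e] with w hw h
      exact ⟨by simpa using hw h, hb⟩
  filter_upwards [e1, e0] with w hw1 hw0 hpos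
  have hwa : w.1 = a := by simpa using hw1 hpos
  refine ⟨hwa, le_antisymm (le_of_not_gt fun h0 => ?_) (w.2.2.1 0)⟩
  obtain ⟨hx, hb⟩ := hw0 h0
  rcases hab with ha | hb'
  · exact ha (hwa.symm.trans hx)
  · exact hb hb'

/-- The canonical lift is pure by construction, so no condition on a and b is required; the case a =
0, b = 1/2 separates `staticW` from `semiD`. -/
theorem le_staticW_twoAtoms (a b : ℝ) :
    ENNReal.ofReal (b * (a ^ 2 + 2)) ^ (1 / 2 : ℝ) ≤
      staticW arith twoNode (twoAtoms 0 0) (twoAtoms a b) := by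
  refine le_liftW (proj_canonicalLift_twoAtoms 0 0) (proj_canonicalLift_twoAtoms a b) ?_
  rw [canonicalLift_twoAtoms, mix, ae_add_measure_iff]
  constructor <;> refine Measure.ae_smul_measure ?_ _
  · simp [ae_dirac_eq, vertex]
  · simp [ae_dirac_eq, vertex]

/-! ### Lower bounds for the dynamic action -/

theorem ofReal_le_of_forall_sub {x : ℝ} {y : ℝ≥0∞}
    (h : ∀ ε : ℝ, 0 < ε → ENNReal.ofReal (x - ε) ≤ y) : ENNReal.ofReal x ≤ y := by
  by_cases hy : y = ⊤
  · simp [hy]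
  rw [ENNReal.ofReal_le_iff_le_toReal hy]
  refine le_of_forall_pos_le_add fun ε hε => ?_
  have := (ENNReal.ofReal_le_iff_le_toReal hy).1 (h ε hε)
  linarith

section Densities

variable {ρ : Fin 2 → Measure ℝ}

theorem isProbabilityMeasure_total (hρ : IsVVProb ρ) : IsProbabilityMeasure (total ρ) :=
  ⟨by simpa [total, IsVVProb] using hρ⟩

theorem isFiniteMeasure_of_isVVProb (hρ : IsVVProb ρ) (i : Fin 2) : IsFiniteMeasure (ρ i) :=
  ⟨lt_of_le_of_lt (Finset.single_le_sum (f := fun i => ρ i univ) (fun _ _ => zero_le)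
    (Finset.mem_univ i)) (by rw [show ∑ i, ρ i univ = 1 from hρ]; exact ENNReal.one_lt_top)⟩

theorem measure_univ_le_one (hρ : IsVVProb ρ) (i : Fin 2) : ρ i univ ≤ 1 :=
  (Finset.single_le_sum (f := fun i => ρ i univ) (fun _ _ => zero_le)
    (Finset.mem_univ i)).trans_eq hρ

theorem ae_dens_add (hρ : IsVVProb ρ) : ∀ᵐ x ∂(total ρ), dens ρ 0 x + dens ρ 1 x = 1 := by
  have := isProbabilityMeasure_total hρ
  have := isFiniteMeasure_of_isVVProb hρ
  have h1 := Measure.rnDeriv_add' (ρ 0) (ρ 1) (total ρ)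
  have h2 : (ρ 0 + ρ 1).rnDeriv (total ρ) =ᵐ[total ρ] fun _ => 1 := by
    have : ρ 0 + ρ 1 = total ρ := by simp [total, Fin.sum_univ_two]
    rw [this]
    exact Measure.rnDeriv_self _
  filter_upwards [h1, h2, (ρ 0).rnDeriv_lt_top (total ρ), (ρ 1).rnDeriv_lt_top (total ρ)]
    with x a1 a2 a3 a4
  rw [dens, dens, ← ENNReal.toReal_add a3.ne a4.ne]
  rw [a2, Pi.add_apply] at a1
  rw [← a1, ENNReal.toReal_one]

/-- The two densities sum to 1 and the arithmetic mean sees only their sum; this decouples the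
exchange action from the shape of ρ. -/
theorem ae_edgeDens_arith (hρ : IsVVProb ρ) {i j : Fin 2} (hij : i ≠ j) :
    ∀ᵐ x ∂(total ρ), edgeDens arith ρ i j x = 1 / 2 := by
  filter_upwards [ae_dens_add hρ] with x hx
  have hx' : dens ρ 1 x + dens ρ 0 x = 1 := by rw [add_comm, hx]
  fin_cases i <;> fin_cases j <;> simp_all [edgeDens, arith]

theorem edgeDens_arith_comm (i j : Fin 2) (x : ℝ) :
    edgeDens arith ρ i j x = edgeDens arith ρ j i x := by
  simp only [edgeDens, arith, add_comm]

theorem vvNormSq_arith (hρ : IsVVProb ρ) (u : Fin 2 → ℝ → ℝ) {v : Fin 2 → Fin 2 → ℝ → ℝ}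
    (hv : ∀ i j, Measurable (v i j)) :
    vvNormSq arith twoNode ρ u v =
      ∫⁻ x, ENNReal.ofReal (u 0 x ^ 2) ∂(ρ 0) + ∫⁻ x, ENNReal.ofReal (u 1 x ^ 2) ∂(ρ 1) +
        ∫⁻ x, ENNReal.ofReal ((v 0 1 x ^ 2 + v 1 0 x ^ 2) / 4) ∂(total ρ) := by
  have e : ∀ i j, i ≠ j → ∫⁻ x, ENNReal.ofReal (v i j x ^ 2 * edgeDens arith ρ i j x * 1) ∂(total ρ)
      = 2 * ∫⁻ x, ENNReal.ofReal (v i j x ^ 2 / 4) ∂(total ρ) := by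
    intro i j hij
    rw [← lintegral_const_mul _ (((hv i j).pow_const 2).div_const 4).ennreal_ofReal]
    refine lintegral_congr_ae ?_
    filter_upwards [ae_edgeDens_arith hρ hij] with x hx
    rw [hx, show (2 : ℝ≥0∞) = ENNReal.ofReal 2 by simp, ← ENNReal.ofReal_mul (by norm_num)]
    congr 1
    ring
  simp only [vvNormSq, Fin.sum_univ_two, twoNode]
  simp only [if_true, if_false, Fin.isValue, zero_ne_one, one_ne_zero, mul_zero,
    ENNReal.ofReal_zero, lintegral_zero, zero_add, add_zero]
  rw [e 0 1 (by simp), e 1 0 (by simp), ← mul_add, ← mul_assoc, one_div,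
    ENNReal.inv_mul_cancel (by simp) (by simp), one_mul,
    ← lintegral_add_left (((hv 0 1).pow_const 2).div_const 4).ennreal_ofReal]
  congr 1
  refine lintegral_congr fun x => ?_
  rw [add_div, ENNReal.ofReal_add (by positivity) (by positivity)]

end Densities

section Lower

variable {ρ : ℝ → Fin 2 → Measure ℝ} {u : Fin 2 → ℝ → ℝ → ℝ} {v : Fin 2 → Fin 2 → ℝ → ℝ → ℝ}
  {φ ψ : ℝ → ℝ}

/-- The vector valued continuity equation tested against a product `φ(t) ψ(x)`. -/
theorem VVContinuityEq.test_prod {θ : ℝ → ℝ → ℝ} (h : VVContinuityEq θ twoNode ρ u v)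
    (hφ : ContDiff ℝ ∞ φ) (hφc : HasCompactSupport φ) (hφs : tsupport φ ⊆ Ioo 0 1)
    (hψ : ContDiff ℝ ∞ ψ) (hψc : HasCompactSupport ψ) {i j : Fin 2} (hij : i ≠ j) :
    ∫ t in Icc (0 : ℝ) 1, deriv φ t * ∫ x, ψ x ∂(ρ t i) =
      -(∫ t in Icc (0 : ℝ) 1, ∫ x, φ t * deriv ψ x * u i x t ∂(ρ t i)) -
        1 / 2 * ∫ t in Icc (0 : ℝ) 1, ∫ x, φ t * ψ x * edgeDens θ (ρ t) i j x *
          (v i j x t - v j i x t) ∂(total (ρ t)) := by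
  have hsub : tsupport (fun z : ℝ × ℝ => φ z.2 * ψ z.1) ⊆ tsupport ψ ×ˢ tsupport φ := by
    refine closure_minimal (fun z hz => ?_) ((isClosed_tsupport ψ).prod (isClosed_tsupport φ))
    exact ⟨subset_tsupport ψ (right_ne_zero_of_mul hz), subset_tsupport φ (left_ne_zero_of_mul hz)⟩
  have := h.equation (fun z => φ z.2 * ψ z.1) (by fun_prop)
    (HasCompactSupport.of_support_subset_isCompact (hψc.isCompact.prod hφc.isCompact)
      ((subset_tsupport _).trans hsub))
    (hsub.trans (prod_mono (subset_univ _) hφs)) i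
  simp only [deriv_mul_const_field, deriv_const_mul_field, integral_const_mul] at this
  rw [this]
  congr 2
  rw [Fin.sum_univ_two]
  fin_cases i <;> fin_cases j <;> simp_all [twoNode]

/-- Young's inequality 2φψ'u ≤ (φψ')² + u², with each component of mass at most 1. -/
theorem ofReal_two_mul_transport_le (h : ∀ t ∈ Icc (0 : ℝ) 1, IsVVProb (ρ t))
    (hφ : ∀ t, |φ t| ≤ 1) {B : ℝ} (hψ : ∀ x, |deriv ψ x| ≤ B) (i : Fin 2) :
    ENNReal.ofReal (2 * ∫ t in Icc (0 : ℝ) 1, ∫ x, φ t * deriv ψ x * u i x t ∂(ρ t i)) ≤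
      ∫⁻ t in Icc (0 : ℝ) 1,
        (ENNReal.ofReal (B ^ 2) + ∫⁻ x, ENNReal.ofReal (u i x t ^ 2) ∂(ρ t i)) := by
  simp_rw [← integral_const_mul]
  refine (ofReal_integral_le_lintegral _ _).trans
    (setLIntegral_mono' measurableSet_Icc fun t ht => ?_)
  refine (ofReal_integral_le_lintegral _ _).trans ?_
  calc ∫⁻ x, ENNReal.ofReal (2 * (φ t * deriv ψ x * u i x t)) ∂(ρ t i)
      ≤ ∫⁻ x, (ENNReal.ofReal (B ^ 2) + ENNReal.ofReal (u i x t ^ 2)) ∂(ρ t i) := by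
        refine lintegral_mono fun x => ?_
        rw [← ENNReal.ofReal_add (by positivity) (by positivity)]
        apply ENNReal.ofReal_le_ofReal
        have h1 : |φ t * deriv ψ x| ≤ B := by
          rw [abs_mul]
          calc |φ t| * |deriv ψ x| ≤ 1 * B :=
                mul_le_mul (hφ t) (hψ x) (abs_nonneg _) zero_le_one
            _ = B := one_mul B
        have h2 : (φ t * deriv ψ x) ^ 2 ≤ B ^ 2 := sq_le_sq' (abs_le.1 h1).1 (abs_le.1 h1).2
        nlinarith [sq_nonneg (φ t * deriv ψ x - u i x t)]
    _ ≤ ENNReal.ofReal (B ^ 2) + ∫⁻ x, ENNReal.ofReal (u i x t ^ 2) ∂(ρ t i) := by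
        rw [lintegral_add_left measurable_const, lintegral_const]
        gcongr
        exact mul_le_of_le_one_right' (measure_univ_le_one (h t ht) i)

/-- With mobility 1/2 and s = φψ, completing squares gives s(v_ij - v_ji)/2 ≤ s² + (v_ij² +
v_ji²)/8. The right side carries half of the exchange action, so the inequalities for the two
components together use it exactly once. -/
theorem ofReal_exchange_le (h : ∀ t ∈ Icc (0 : ℝ) 1, IsVVProb (ρ t))
    (hφ : ∀ t, |φ t| ≤ 1) (hψ : ∀ x, |ψ x| ≤ 1) {i j : Fin 2} (hij : i ≠ j) :
    ENNReal.ofReal (∫ t in Icc (0 : ℝ) 1, ∫ x, φ t * ψ x * edgeDens arith (ρ t) i j x *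
        (v i j x t - v j i x t) ∂(total (ρ t))) ≤
      ∫⁻ t in Icc (0 : ℝ) 1, (1 + 1 / 2 *
        ∫⁻ x, ENNReal.ofReal ((v 0 1 x t ^ 2 + v 1 0 x t ^ 2) / 4) ∂(total (ρ t))) := by
  refine (ofReal_integral_le_lintegral _ _).trans
    (setLIntegral_mono' measurableSet_Icc fun t ht => ?_)
  have := isProbabilityMeasure_total (h t ht)
  refine (ofReal_integral_le_lintegral _ _).trans ?_
  calc _ ≤ ∫⁻ x, (1 + 1 / 2 * ENNReal.ofReal ((v 0 1 x t ^ 2 + v 1 0 x t ^ 2) / 4))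
          ∂(total (ρ t)) := by
        refine lintegral_mono_ae ?_
        filter_upwards [ae_edgeDens_arith (h t ht) hij] with x hx
        have hh : (1 / 2 : ℝ≥0∞) = ENNReal.ofReal (1 / 2) := by
          rw [ENNReal.ofReal_div_of_pos two_pos]
          simp
        rw [hx, hh, ← ENNReal.ofReal_one, ← ENNReal.ofReal_mul (by norm_num),
          ← ENNReal.ofReal_add (by norm_num) (by positivity)]
        apply ENNReal.ofReal_le_ofReal
        have h1 : |φ t * ψ x| ≤ 1 := by
          rw [abs_mul]
          exact mul_le_one₀ (hφ t) (abs_nonneg _) (hψ x)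
        have h2 : (φ t * ψ x) ^ 2 ≤ 1 := by
          have := abs_le.1 h1
          nlinarith
        have h3 : v i j x t ^ 2 + v j i x t ^ 2 = v 0 1 x t ^ 2 + v 1 0 x t ^ 2 := by
          fin_cases i <;> fin_cases j <;> simp_all [add_comm]
        rw [← h3]
        nlinarith [sq_nonneg (v i j x t - 2 * (φ t * ψ x)), sq_nonneg (v j i x t + 2 * (φ t * ψ x))]
    _ = 1 + 1 / 2 * ∫⁻ x, ENNReal.ofReal ((v 0 1 x t ^ 2 + v 1 0 x t ^ 2) / 4) ∂(total (ρ t)) := by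
        rw [lintegral_add_left measurable_const, lintegral_const_mul' _ _ (by simp)]
        simp

theorem VVContinuityEq.exists_time_cutoff_sub_le {θ : ℝ → ℝ → ℝ} {q : Fin 2 → Fin 2 → ℝ}
    (h : VVContinuityEq θ q ρ u v) {ψ : Fin 2 → ℝ → ℝ}
    (hψ : ∀ i, ContDiff ℝ ∞ (ψ i)) (hψc : ∀ i, HasCompactSupport (ψ i)) {ε : ℝ} (hε : 0 < ε) :
    ∃ φ : ℝ → ℝ, ContDiff ℝ ∞ φ ∧ HasCompactSupport φ ∧ tsupport φ ⊆ Ioo 0 1 ∧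
      (∀ t, |φ t| ≤ 1) ∧ ∀ i, (∫ x, ψ i x ∂(ρ 1 i)) - (∫ x, ψ i x ∂(ρ 0 i)) - ε ≤
        -∫ t in Icc (0 : ℝ) 1, deriv φ t * ∫ x, ψ i x ∂(ρ t i) := by
  obtain ⟨φ, h1, h2, h3, h4, h5⟩ := exists_time_cutoff (fun i t => ∫ x, ψ i x ∂(ρ t i))
    (fun i => by
      obtain ⟨C, hC⟩ := (hψc i).exists_bound_of_continuous (hψ i).continuous
      exact h.narrow_continuous i
        (BoundedContinuousFunction.ofNormedAddCommGroup (ψ i) (hψ i).continuous C hC)) hε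
  refine ⟨φ, h1, h2, h3, h4, fun i => ?_⟩
  have := (abs_le.1 (h5 i)).2
  linarith

/-- Lower bound for the action of a curve by bounded test functions of small slope. -/
theorem VVContinuityEq.two_mul_sub_le (h : VVContinuityEq arith twoNode ρ u v)
    {ψ : Fin 2 → ℝ → ℝ} (hψ : ∀ i, ContDiff ℝ ∞ (ψ i)) (hψc : ∀ i, HasCompactSupport (ψ i))
    (hψ1 : ∀ i x, |ψ i x| ≤ 1) {B : ℝ} (hψB : ∀ i x, |deriv (ψ i) x| ≤ B) :
    ENNReal.ofReal (2 * ∑ i, ((∫ x, ψ i x ∂(ρ 1 i)) - ∫ x, ψ i x ∂(ρ 0 i))) ≤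
      ENNReal.ofReal (2 * B ^ 2 + 2) + ∫⁻ t in Icc (0 : ℝ) 1,
        vvNormSq arith twoNode (ρ t) (fun i x => u i x t) (fun i j x => v i j x t) := by
  refine ofReal_le_of_forall_sub fun ε hε => ?_
  obtain ⟨φ, h1, h2, h3, h4, h5⟩ :=
    h.exists_time_cutoff_sub_le hψ hψc (show 0 < ε / 4 by positivity)
  have g0 := h5 0
  have g1 := h5 1
  rw [h.test_prod h1 h2 h3 (hψ 0) (hψc 0) zero_ne_one] at g0
  rw [h.test_prod h1 h2 h3 (hψ 1) (hψc 1) one_ne_zero] at g1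
  have U0 := ofReal_two_mul_transport_le (u := u) h.isVVProb h4 (hψB 0) 0
  have U1 := ofReal_two_mul_transport_le (u := u) h.isVVProb h4 (hψB 1) 1
  have T0 := ofReal_exchange_le (v := v) h.isVVProb h4 (hψ1 0) zero_ne_one
  have T1 := ofReal_exchange_le (v := v) h.isVVProb h4 (hψ1 1) one_ne_zero
  rw [Fin.sum_univ_two]
  refine (ENNReal.ofReal_le_ofReal (q := (_ + _) + (_ + _)) ?_).trans
    ((ENNReal.ofReal_add_le.trans (add_le_add ENNReal.ofReal_add_le ENNReal.ofReal_add_le)).trans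
    ((add_le_add (add_le_add U0 U1) (add_le_add T0 T1)).trans ?_))
  · linarith
  -- Superadditivity of the lower integral holds without measurability, so nothing has to be known
  -- about how the inner integrals depend on t.
  · refine ((add_le_add (le_lintegral_add _ _) (le_lintegral_add _ _)).trans
      (le_lintegral_add _ _)).trans ?_
    have hconst : ENNReal.ofReal (2 * B ^ 2 + 2)
        = ∫⁻ _ in Icc (0 : ℝ) 1, ENNReal.ofReal (2 * B ^ 2 + 2) := by simp
    rw [hconst, ← lintegral_add_left measurable_const]
    refine setLIntegral_mono' measurableSet_Icc fun t ht => ?_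
    rw [vvNormSq_arith (v := fun i j x => v i j x t) (h.isVVProb t ht) _
      (fun i j => (h.measurable_v i j).comp measurable_prodMk_right)]
    rw [ENNReal.ofReal_add (by positivity) (by norm_num), two_mul,
      ENNReal.ofReal_add (by positivity) (by positivity)]
    set V := ∫⁻ x, ENNReal.ofReal ((v 0 1 x t ^ 2 + v 1 0 x t ^ 2) / 4) ∂(total (ρ t))
    have hV : V = 1 / 2 * V + 1 / 2 * V := by
      rw [← add_mul, ENNReal.add_halves, one_mul]
    have h2' : ENNReal.ofReal 2 = 1 + 1 := by
      rw [ENNReal.ofReal_ofNat]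
      norm_num
    conv_rhs => rw [hV, h2']
    apply le_of_eq
    abel

/-- Lower bound for the action of a curve in terms of the total spatial transport. -/
theorem VVContinuityEq.two_mul_total_sub_le (h : VVContinuityEq arith twoNode ρ u v)
    (hψ : ContDiff ℝ ∞ ψ) (hψc : HasCompactSupport ψ) {B : ℝ} (hψB : ∀ x, |deriv ψ x| ≤ B) :
    ENNReal.ofReal (2 * ∑ i, ((∫ x, ψ x ∂(ρ 1 i)) - ∫ x, ψ x ∂(ρ 0 i))) ≤
      ENNReal.ofReal (2 * B ^ 2) + ∫⁻ t in Icc (0 : ℝ) 1,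
        vvNormSq arith twoNode (ρ t) (fun i x => u i x t) (fun i j x => v i j x t) := by
  refine ofReal_le_of_forall_sub fun ε hε => ?_
  obtain ⟨φ, h1, h2, h3, h4, h5⟩ :=
    h.exists_time_cutoff_sub_le (ψ := fun _ => ψ) (fun _ => hψ) (fun _ => hψc)
      (show 0 < ε / 4 by positivity)
  have g0 := h5 0
  have g1 := h5 1
  rw [h.test_prod h1 h2 h3 hψ hψc zero_ne_one] at g0
  rw [h.test_prod h1 h2 h3 hψ hψc one_ne_zero] at g1
  -- With the same ψ in both components the exchange terms cancel: exchange conserves the total mass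
  -- at each point. Hence ψ itself need not be bounded by 1, only its slope by B.
  have hT : ∫ t in Icc (0 : ℝ) 1, ∫ x, φ t * ψ x * edgeDens arith (ρ t) 1 0 x *
      (v 1 0 x t - v 0 1 x t) ∂(total (ρ t)) =
      -∫ t in Icc (0 : ℝ) 1, ∫ x, φ t * ψ x * edgeDens arith (ρ t) 0 1 x *
      (v 0 1 x t - v 1 0 x t) ∂(total (ρ t)) := by
    simp_rw [← integral_neg]
    congr 1
    ext t
    congr 1
    ext x
    rw [edgeDens_arith_comm]
    ring
  rw [hT] at g1
  have U0 := ofReal_two_mul_transport_le (u := u) h.isVVProb h4 hψB 0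
  have U1 := ofReal_two_mul_transport_le (u := u) h.isVVProb h4 hψB 1
  rw [Fin.sum_univ_two]
  refine (ENNReal.ofReal_le_ofReal (q := _ + _) ?_).trans
    (ENNReal.ofReal_add_le.trans ((add_le_add U0 U1).trans ?_))
  · linarith
  · refine (le_lintegral_add _ _).trans ?_
    have hconst : ENNReal.ofReal (2 * B ^ 2)
        = ∫⁻ _ in Icc (0 : ℝ) 1, ENNReal.ofReal (2 * B ^ 2) := by simp
    rw [hconst, ← lintegral_add_left measurable_const]
    refine setLIntegral_mono' measurableSet_Icc fun t ht => ?_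
    rw [vvNormSq_arith (v := fun i j x => v i j x t) (h.isVVProb t ht) _
      (fun i j => (h.measurable_v i j).comp measurable_prodMk_right)]
    rw [two_mul, ENNReal.ofReal_add (by positivity) (by positivity)]
    rw [add_add_add_comm, ← add_assoc _ _ (∫⁻ x, ENNReal.ofReal (_ / 4) ∂_)]
    exact le_self_add

end Lower

/-! ### A competitor: exchange at a point, followed by transport -/

theorem deriv_snd_eq {η : ℝ × ℝ → ℝ} (hη : ContDiff ℝ ∞ η) (x t : ℝ) :
    deriv (fun s => η (x, s)) t = fderiv ℝ η (x, t) (0, 1) := by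
  have h1 : HasFDerivAt η (fderiv ℝ η (x, t)) (x, t) :=
    ((hη.differentiable (by simp)) (x, t)).hasFDerivAt
  exact (h1.comp_hasDerivAt t ((hasDerivAt_const t x).prodMk (hasDerivAt_id t))).deriv

theorem deriv_fst_eq {η : ℝ × ℝ → ℝ} (hη : ContDiff ℝ ∞ η) (x t : ℝ) :
    deriv (fun y => η (y, t)) x = fderiv ℝ η (x, t) (1, 0) := by
  have h1 : HasFDerivAt η (fderiv ℝ η (x, t)) (x, t) :=
    ((hη.differentiable (by simp)) (x, t)).hasFDerivAt
  exact (h1.comp_hasDerivAt x ((hasDerivAt_id x).prodMk (hasDerivAt_const x t))).deriv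

/-- Integration by parts along the path of a moving point mass `w(t) δ_{y(t)}`. -/
theorem integral_along_path {η : ℝ × ℝ → ℝ} (hη : ContDiff ℝ ∞ η)
    (hs : tsupport η ⊆ univ ×ˢ Ioo 0 1) {y w Y W : ℝ → ℝ} (hy : Continuous y)
    (hw : Continuous w) {τ : ℝ} (hy' : ∀ t, t ≠ τ → HasDerivAt y (Y t) t)
    (hw' : ∀ t, t ≠ τ → HasDerivAt w (W t) t) (hY : IntegrableOn Y (Icc 0 1))
    (hW : IntegrableOn W (Icc 0 1)) :
    ∫ t in Icc (0 : ℝ) 1, w t * deriv (fun s => η (y t, s)) t =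
      -(∫ t in Icc (0 : ℝ) 1, w t * (deriv (fun x => η (x, t)) (y t) * Y t)) -
        ∫ t in Icc (0 : ℝ) 1, η (y t, t) * W t := by
  simp_rw [deriv_snd_eq hη, deriv_fst_eq hη]
  have hfd : Continuous (fderiv ℝ η) := hη.continuous_fderiv (by simp)
  have hηc : Continuous η := hη.continuous
  have i1 : IntegrableOn (fun t => w t * fderiv ℝ η (y t, t) (0, 1)) (Icc 0 1) :=
    Continuous.integrableOn_Icc (by fun_prop)
  have i2 : IntegrableOn (fun t => w t * (fderiv ℝ η (y t, t) (1, 0) * Y t)) (Icc 0 1) := by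
    simp_rw [← mul_assoc]
    exact hY.continuousOn_mul (by fun_prop) isCompact_Icc
  have i3 : IntegrableOn (fun t => η (y t, t) * W t) (Icc 0 1) :=
    hW.continuousOn_mul (by fun_prop) isCompact_Icc
  have hz : ∀ x t : ℝ, t ∉ Ioo (0 : ℝ) 1 → η (x, t) = 0 := fun x t ht =>
    image_eq_zero_of_notMem_tsupport fun h => ht (hs h).2
  have i12 : IntegrableOn (fun t => w t * fderiv ℝ η (y t, t) (0, 1) +
    w t * (fderiv ℝ η (y t, t) (1, 0) * Y t)) (Icc 0 1) := i1.add i2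
  have i123 : IntegrableOn (fun t => w t * fderiv ℝ η (y t, t) (0, 1) +
    w t * (fderiv ℝ η (y t, t) (1, 0) * Y t) + η (y t, t) * W t) (Icc 0 1) := i12.add i3
  have key := integral_eq_of_hasDerivAt_off_countable_of_le (fun t => η (y t, t) * w t)
    (fun t => w t * fderiv ℝ η (y t, t) (0, 1) +
      w t * (fderiv ℝ η (y t, t) (1, 0) * Y t) + η (y t, t) * W t)
    (a := 0) (b := 1) zero_le_one (countable_singleton τ) (by fun_prop)
    -- The path has a kink at τ, where the fundamental theorem of calculus tolerates a missing
    -- derivative.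
    (fun t ht => by
      have hne : t ≠ τ := ht.2
      have h1 : HasFDerivAt η (fderiv ℝ η (y t, t)) (y t, t) :=
        ((hη.differentiable (by simp)) (y t, t)).hasFDerivAt
      have h2 := h1.comp_hasDerivAt (f := fun s => (y s, s)) t
        ((hy' t hne).prodMk (hasDerivAt_id t))
      refine (h2.mul (hw' t hne)).congr_deriv ?_
      have : ((Y t, 1) : ℝ × ℝ) = Y t • (1, 0) + (0, 1) := by simp
      rw [this, map_add, map_smul, smul_eq_mul]
      simp only [Function.comp_apply]
      ring)
    ((intervalIntegrable_iff_integrableOn_Icc_of_le zero_le_one).2 i123)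
  rw [hz _ 1 (by simp), hz _ 0 (by simp), zero_mul, zero_mul, sub_zero,
    intervalIntegral.integral_of_le zero_le_one, ← integral_Icc_eq_integral_Ioc,
    integral_add i12 i3, integral_add i1 i2] at key
  linarith

section Curve

variable (b τ c : ℝ)

/-- The mass in the second layer of a curve that exchanges mass up to time `τ`. -/
noncomputable def curveMass (t : ℝ) : ℝ := b * min (t / τ) 1

/-- The position in the second layer of a curve that moves from time `τ` on. -/
noncomputable def curvePos (t : ℝ) : ℝ := c * max (t - τ) 0

noncomputable def curveRate (t : ℝ) : ℝ := if t < τ then b / τ else 0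

noncomputable def curveSpeed (t : ℝ) : ℝ := if t < τ then 0 else c

variable {b τ c}

theorem continuous_curveMass : Continuous (curveMass b τ) := by
  unfold curveMass
  fun_prop

theorem continuous_curvePos : Continuous (curvePos τ c) := by
  unfold curvePos
  fun_prop

theorem measurable_curveRate : Measurable (curveRate b τ) :=
  Measurable.ite measurableSet_Iio measurable_const measurable_const

theorem measurable_curveSpeed : Measurable (curveSpeed τ c) :=
  Measurable.ite measurableSet_Iio measurable_const measurable_const

theorem abs_curveRate_le (t : ℝ) : |curveRate b τ t| ≤ |b / τ| := by
  unfold curveRate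
  split_ifs <;> simp [abs_nonneg]

theorem abs_curveSpeed_le (t : ℝ) : |curveSpeed τ c t| ≤ |c| := by
  unfold curveSpeed
  split_ifs <;> simp [abs_nonneg]

theorem integrableOn_curveRate : IntegrableOn (curveRate b τ) (Icc 0 1) :=
  Measure.integrableOn_of_bounded (M := |b / τ|) (by simp)
    measurable_curveRate.aestronglyMeasurable
    (Filter.Eventually.of_forall fun t => abs_curveRate_le t)

theorem integrableOn_curveSpeed : IntegrableOn (curveSpeed τ c) (Icc 0 1) :=
  Measure.integrableOn_of_bounded (M := |c|) (by simp)
    measurable_curveSpeed.aestronglyMeasurable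
    (Filter.Eventually.of_forall fun t => abs_curveSpeed_le t)

theorem curveMass_mem (hb0 : 0 ≤ b) (hb1 : b ≤ 1) (hτ : 0 < τ) {t : ℝ} (ht : 0 ≤ t) :
    0 ≤ curveMass b τ t ∧ curveMass b τ t ≤ b ∧ curveMass b τ t ≤ 1 := by
  have h1 : 0 ≤ min (t / τ) 1 := le_min (by positivity) zero_le_one
  have h2 : b * min (t / τ) 1 ≤ b := mul_le_of_le_one_right hb0 (min_le_right _ _)
  exact ⟨mul_nonneg hb0 h1, h2, h2.trans hb1⟩

theorem hasDerivAt_curveMass (hτ : 0 < τ) {t : ℝ} (ht : t ≠ τ) :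
    HasDerivAt (curveMass b τ) (curveRate b τ t) t := by
  rcases lt_or_gt_of_ne ht with h | h
  · have e : curveMass b τ =ᶠ[nhds t] fun s => b * (s / τ) := by
      filter_upwards [Iio_mem_nhds h] with s hs
      rw [curveMass, min_eq_left ((div_le_one hτ).2 (mem_Iio.1 hs).le)]
    rw [curveRate, if_pos h]
    refine HasDerivAt.congr_of_eventuallyEq ?_ e
    exact (((hasDerivAt_id t).div_const τ).const_mul b).congr_deriv (by ring)
  · have e : curveMass b τ =ᶠ[nhds t] fun _ => b * 1 := by
      filter_upwards [Ioi_mem_nhds h] with s hs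
      rw [curveMass, min_eq_right ((one_le_div hτ).2 (mem_Ioi.1 hs).le)]
    rw [curveRate, if_neg h.not_gt]
    exact (hasDerivAt_const t _).congr_of_eventuallyEq e

theorem hasDerivAt_curvePos {t : ℝ} (ht : t ≠ τ) :
    HasDerivAt (curvePos τ c) (curveSpeed τ c t) t := by
  rcases lt_or_gt_of_ne ht with h | h
  · have e : curvePos τ c =ᶠ[nhds t] fun _ => c * 0 := by
      filter_upwards [Iio_mem_nhds h] with s hs
      rw [curvePos, max_eq_right (by linarith [mem_Iio.1 hs])]
    rw [curveSpeed, if_pos h]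
    exact (hasDerivAt_const t _).congr_of_eventuallyEq e
  · have e : curvePos τ c =ᶠ[nhds t] fun s => c * (s - τ) := by
      filter_upwards [Ioi_mem_nhds h] with s hs
      rw [curvePos, max_eq_left (by linarith [mem_Ioi.1 hs])]
    rw [curveSpeed, if_neg h.not_gt]
    refine HasDerivAt.congr_of_eventuallyEq ?_ e
    exact (((hasDerivAt_id t).sub_const τ).const_mul c).congr_deriv (by ring)

variable (b τ c)

noncomputable def curve (t : ℝ) : Fin 2 → Measure ℝ := twoAtoms (curvePos τ c t) (curveMass b τ t)

noncomputable def curveU (i : Fin 2) (_ t : ℝ) : ℝ := ![0, curveSpeed τ c t] i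

noncomputable def curveV (i j : Fin 2) (_ t : ℝ) : ℝ :=
  ![![0, -2 * curveRate b τ t], ![2 * curveRate b τ t, 0]] i j

variable {b τ c}

theorem isVVProb_curve (hb0 : 0 ≤ b) (hb1 : b ≤ 1) (hτ : 0 < τ) {t : ℝ} (ht : 0 ≤ t) :
    IsVVProb (curve b τ c t) :=
  have h := curveMass_mem hb0 hb1 hτ ht
  (isVVProb₂_twoAtoms _ h.1 h.2.2).1

theorem measurable_curveV (i j : Fin 2) :
    Measurable fun z : ℝ × ℝ => curveV b τ i j z.1 z.2 := by
  have := (measurable_curveRate (b := b) (τ := τ)).comp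
    (measurable_snd : Measurable fun z : ℝ × ℝ => z.2)
  fin_cases i <;> fin_cases j
  · exact measurable_const
  · exact this.const_mul (-2)
  · exact this.const_mul 2
  · exact measurable_const

theorem total_curve_of_lt (hb0 : 0 ≤ b) (hb1 : b ≤ 1) (hτ : 0 < τ) {t : ℝ} (ht : 0 ≤ t)
    (h : t < τ) : total (curve b τ c t) = Measure.dirac 0 := by
  have hm := curveMass_mem hb0 hb1 hτ ht
  have hx : curvePos τ c t = 0 := by rw [curvePos, max_eq_right (by linarith), mul_zero]
  simp only [total, curve, twoAtoms, Fin.sum_univ_two, hx, Matrix.cons_val_zero,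
    Matrix.cons_val_one]
  rw [← add_smul, ofReal_one_sub_add hm.1 hm.2.2, one_smul]

/-- Before τ both atoms lie at 0, so the total measure is a Dirac mass with mobility 1/2; from τ on
the exchange velocity is zero. -/
theorem integral_exchange_curve (hb0 : 0 ≤ b) (hb1 : b ≤ 1) (hτ : 0 < τ) {t : ℝ} (ht : 0 ≤ t)
    (f : ℝ → ℝ) {i j : Fin 2} (hij : i ≠ j) :
    ∫ x, f x * edgeDens arith (curve b τ c t) i j x * (curveV b τ i j x t - curveV b τ j i x t)
      ∂(total (curve b τ c t)) = f (curvePos τ c t) * curveV b τ i j 0 t := by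
  have hanti : ∀ x, curveV b τ i j x t - curveV b τ j i x t = 2 * curveV b τ i j 0 t := by
    intro x
    fin_cases i <;> fin_cases j <;> simp_all [curveV]
    · ring
    · ring
  simp_rw [hanti]
  by_cases h : t < τ
  · have hx : curvePos τ c t = 0 := by rw [curvePos, max_eq_right (by linarith), mul_zero]
    have : ∫ x, f x * edgeDens arith (curve b τ c t) i j x * (2 * curveV b τ i j 0 t)
        ∂(total (curve b τ c t)) = ∫ x, f x * curveV b τ i j 0 t ∂(total (curve b τ c t)) := by
      refine integral_congr_ae ?_
      filter_upwards [ae_edgeDens_arith (isVVProb_curve (c := c) hb0 hb1 hτ ht) hij] with x hx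
      rw [hx]
      ring
    rw [this, total_curve_of_lt hb0 hb1 hτ ht h, integral_dirac, hx]
  · have : curveV b τ i j 0 t = 0 := by
      fin_cases i <;> fin_cases j <;> simp [curveV, curveRate, h]
    simp [this]

theorem integral_curve_zero (hb0 : 0 ≤ b) (hb1 : b ≤ 1) (hτ : 0 < τ) {t : ℝ} (ht : 0 ≤ t)
    (f : ℝ → ℝ) : ∫ x, f x ∂(curve b τ c t 0) = (1 - curveMass b τ t) * f 0 := by
  have hm := curveMass_mem hb0 hb1 hτ ht
  simp only [curve, twoAtoms, Matrix.cons_val_zero]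
  rw [integral_smul_measure, integral_dirac, ENNReal.toReal_ofReal (by linarith), smul_eq_mul]

theorem integral_curve_one (hb0 : 0 ≤ b) (hb1 : b ≤ 1) (hτ : 0 < τ) {t : ℝ} (ht : 0 ≤ t)
    (f : ℝ → ℝ) : ∫ x, f x ∂(curve b τ c t 1) = curveMass b τ t * f (curvePos τ c t) := by
  have hm := curveMass_mem hb0 hb1 hτ ht
  simp only [curve, twoAtoms, Matrix.cons_val_one, Matrix.cons_val_zero]
  rw [integral_smul_measure, integral_dirac, ENNReal.toReal_ofReal hm.1, smul_eq_mul]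

/-- Each component is one weighted moving atom, so its weak equation is an instance of
`integral_along_path`. -/
theorem vvContinuityEq_curve (hb0 : 0 ≤ b) (hb1 : b ≤ 1) (hτ : 0 < τ) :
    VVContinuityEq arith twoNode (curve b τ c) (curveU τ c) (curveV b τ) where
  isVVProb t ht := isVVProb_curve hb0 hb1 hτ ht.1
  narrow_continuous i f := by
    have hm := continuous_curveMass (b := b) (τ := τ)
    have hx := continuous_curvePos (τ := τ) (c := c)
    have hf := f.continuous
    fin_cases i
    · refine ContinuousOn.congr (f := fun t => (1 - curveMass b τ t) * f 0) (by fun_prop) ?_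
      exact fun t ht => integral_curve_zero hb0 hb1 hτ ht.1 f
    · refine ContinuousOn.congr (f := fun t => curveMass b τ t * f (curvePos τ c t))
        (by fun_prop) ?_
      exact fun t ht => integral_curve_one hb0 hb1 hτ ht.1 f
  measurable_u i := by
    fin_cases i
    · exact measurable_const
    · exact measurable_curveSpeed.comp measurable_snd
  integrable_u i := by
    refine lt_of_le_of_lt (setLIntegral_mono' measurableSet_Icc
      (g := fun _ => ENNReal.ofReal |c|) fun t ht => ?_) (by simp)
    have hle : ∀ x, ENNReal.ofReal |curveU τ c i x t| ≤ ENNReal.ofReal |c| := fun x => by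
      apply ENNReal.ofReal_le_ofReal
      fin_cases i
      · simp [curveU]
      · exact abs_curveSpeed_le t
    refine (lintegral_mono hle).trans ?_
    rw [lintegral_const]
    exact mul_le_of_le_one_right' (measure_univ_le_one (isVVProb_curve hb0 hb1 hτ ht.1) i)
  measurable_v := measurable_curveV
  integrable_v i j := by
    refine lt_of_le_of_lt (setLIntegral_mono' measurableSet_Icc
      (g := fun _ => ENNReal.ofReal |b / τ|) fun t ht => ?_) (by simp)
    have hp := isVVProb_curve (c := c) hb0 hb1 hτ ht.1
    have := isProbabilityMeasure_total hp
    by_cases hij : i = j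
    · subst hij
      have : ∀ x, curveV b τ i i x t = 0 := fun x => by fin_cases i <;> simp [curveV]
      simp [this]
    · refine (lintegral_mono_ae (g := fun _ => ENNReal.ofReal |b / τ|) ?_).trans (by simp)
      filter_upwards [ae_edgeDens_arith hp hij] with x hx
      apply ENNReal.ofReal_le_ofReal
      rw [hx]
      have h1 := abs_curveRate_le (b := b) (τ := τ) t
      have h2 : |curveV b τ i j x t| = 2 * |curveRate b τ t| := by
        fin_cases i <;> fin_cases j <;> simp_all [curveV, abs_mul]
      rw [h2]
      linarith
  equation η hη hc hs i := by
    have hsum : ∀ F : Fin 2 → ℝ → ℝ → ℝ, ∀ j : Fin 2, i ≠ j →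
        ∑ k, ∫ t in Icc (0 : ℝ) 1, ∫ x, F k t x * twoNode i k ∂(total (curve b τ c t)) =
          ∫ t in Icc (0 : ℝ) 1, ∫ x, F j t x ∂(total (curve b τ c t)) := by
      intro F j hij
      rw [Fin.sum_univ_two]
      fin_cases i <;> fin_cases j <;> simp_all [twoNode]
    obtain rfl | rfl : i = 0 ∨ i = 1 := by fin_cases i <;> simp
    · rw [hsum (fun k t x => η (x, t) * edgeDens arith (curve b τ c t) 0 k x *
        (curveV b τ 0 k x t - curveV b τ k 0 x t)) 1 zero_ne_one]
      have e1 : ∫ t in Icc (0 : ℝ) 1, ∫ x, deriv (fun s => η (x, s)) t ∂(curve b τ c t 0) =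
          ∫ t in Icc (0 : ℝ) 1, (1 - curveMass b τ t) * deriv (fun s => η (0, s)) t :=
        setIntegral_congr_fun measurableSet_Icc fun t ht =>
          integral_curve_zero hb0 hb1 hτ ht.1 _
      have e2 : ∫ t in Icc (0 : ℝ) 1, ∫ x, η (x, t) * edgeDens arith (curve b τ c t) 0 1 x *
          (curveV b τ 0 1 x t - curveV b τ 1 0 x t) ∂(total (curve b τ c t)) =
          ∫ t in Icc (0 : ℝ) 1, 2 * (η (0, t) * -curveRate b τ t) := by
        refine setIntegral_congr_fun measurableSet_Icc fun t ht => ?_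
        rw [integral_exchange_curve hb0 hb1 hτ ht.1 (fun x => η (x, t)) zero_ne_one]
        by_cases h : t < τ
        · rw [curvePos, max_eq_right (by linarith), mul_zero]
          simp [curveV]
          ring
        · simp [curveV, curveRate, h]
      have key := integral_along_path hη hs (y := fun _ => 0) (w := fun t => 1 - curveMass b τ t)
        (Y := fun _ => 0) (W := fun t => -curveRate b τ t) (τ := τ) continuous_const
        (continuous_const.sub continuous_curveMass) (fun t _ => hasDerivAt_const t 0)
        (fun t ht => (hasDerivAt_curveMass hτ ht).const_sub 1) integrableOn_zero
        integrableOn_curveRate.neg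
      rw [e1, e2, key, integral_const_mul]
      simp [curveU]
    · rw [hsum (fun k t x => η (x, t) * edgeDens arith (curve b τ c t) 1 k x *
        (curveV b τ 1 k x t - curveV b τ k 1 x t)) 0 one_ne_zero]
      have e1 : ∫ t in Icc (0 : ℝ) 1, ∫ x, deriv (fun s => η (x, s)) t ∂(curve b τ c t 1) =
          ∫ t in Icc (0 : ℝ) 1, curveMass b τ t * deriv (fun s => η (curvePos τ c t, s)) t :=
        setIntegral_congr_fun measurableSet_Icc fun t ht =>
          integral_curve_one hb0 hb1 hτ ht.1 fun x => deriv (fun s => η (x, s)) t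
      have e2 : ∫ t in Icc (0 : ℝ) 1, ∫ x, η (x, t) * edgeDens arith (curve b τ c t) 1 0 x *
          (curveV b τ 1 0 x t - curveV b τ 0 1 x t) ∂(total (curve b τ c t)) =
          ∫ t in Icc (0 : ℝ) 1, 2 * (η (curvePos τ c t, t) * curveRate b τ t) := by
        refine setIntegral_congr_fun measurableSet_Icc fun t ht => ?_
        rw [integral_exchange_curve hb0 hb1 hτ ht.1 (fun x => η (x, t)) one_ne_zero]
        simp [curveV]
        ring
      have e3 : ∫ t in Icc (0 : ℝ) 1, ∫ x, deriv (fun y => η (y, t)) x * curveU τ c 1 x t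
          ∂(curve b τ c t 1) = ∫ t in Icc (0 : ℝ) 1, curveMass b τ t *
            (deriv (fun x => η (x, t)) (curvePos τ c t) * curveSpeed τ c t) :=
        setIntegral_congr_fun measurableSet_Icc fun t ht =>
          integral_curve_one hb0 hb1 hτ ht.1
            fun x => deriv (fun y => η (y, t)) x * curveU τ c 1 x t
      have key := integral_along_path hη hs (τ := τ) continuous_curvePos
        continuous_curveMass (fun t ht => hasDerivAt_curvePos (c := c) ht)
        (fun t ht => hasDerivAt_curveMass (b := b) hτ ht) integrableOn_curveSpeed
        integrableOn_curveRate
      rw [e1, e2, e3, key, integral_const_mul]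
      ring

/-- Exchanging at rate b/τ costs 2(b/τ)² per unit time during [0, τ), and moving the mass b at speed
c costs bc² per unit time afterwards. -/
theorem dynW_twoAtoms_le (hb0 : 0 ≤ b) (hb1 : b ≤ 1) (hτ : 0 < τ) (hτ1 : τ ≤ 1) :
    dynW arith twoNode (twoAtoms 0 0) (twoAtoms (c * (1 - τ)) b) ≤
      ENNReal.ofReal (2 * b ^ 2 / τ + b * c ^ 2 * (1 - τ)) ^ (1 / 2 : ℝ) := by
  refine ENNReal.rpow_le_rpow ?_ (by norm_num)
  refine iInf_le_of_le (curve b τ c) (iInf_le_of_le (curveU τ c) (iInf_le_of_le (curveV b τ)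
    (iInf_le_of_le (vvContinuityEq_curve hb0 hb1 hτ) (iInf_le_of_le ?_ (iInf_le_of_le ?_ ?_)))))
  · simp [curve, curvePos, curveMass, hτ.le]
  · rw [curve, curvePos, curveMass, max_eq_left (by linarith),
      min_eq_right ((one_le_div hτ).2 hτ1), mul_one]
  calc _ ≤ ∫⁻ t in Icc (0 : ℝ) 1,
        ((Iio τ).indicator (fun _ => ENNReal.ofReal (((2 * (b / τ)) ^ 2 + (2 * (b / τ)) ^ 2) / 4)) t +
          (Ici τ).indicator (fun _ => ENNReal.ofReal (b * c ^ 2)) t) := by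
        refine setLIntegral_mono' measurableSet_Icc fun t ht => ?_
        have hp := isVVProb_curve (c := c) hb0 hb1 hτ ht.1
        have := isProbabilityMeasure_total hp
        rw [vvNormSq_arith (v := fun i j x => curveV b τ i j x t) hp _
          (fun i j => (measurable_curveV i j).comp measurable_prodMk_right)]
        by_cases h : t < τ
        · simp [curveU, curveV, curveSpeed, curveRate, h]
        · have hm := curveMass_mem hb0 hb1 hτ ht.1
          rw [ENNReal.ofReal_mul hb0]
          simp [curveU, curveV, curveSpeed, curveRate, h, not_lt.1 h, curve, twoAtoms]
          rw [mul_comm]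
          gcongr
          exact hm.2.1
    _ = ENNReal.ofReal (2 * b ^ 2 / τ + b * c ^ 2 * (1 - τ)) := by
        rw [lintegral_add_left (measurable_const.indicator measurableSet_Iio),
          lintegral_indicator_const measurableSet_Iio, lintegral_indicator_const measurableSet_Ici,
          Measure.restrict_apply measurableSet_Iio, Measure.restrict_apply measurableSet_Ici]
        have s1 : Iio τ ∩ Icc (0 : ℝ) 1 = Ico 0 τ := by
          ext t
          simp only [mem_inter_iff, mem_Iio, mem_Icc, mem_Ico]
          constructor
          · exact fun h => ⟨h.2.1, h.1⟩
          · exact fun h => ⟨h.2, h.1, by linarith [h.2]⟩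
        have s2 : Ici τ ∩ Icc (0 : ℝ) 1 = Icc τ 1 := by
          ext t
          simp only [mem_inter_iff, mem_Ici, mem_Icc]
          constructor
          · exact fun h => ⟨h.1, h.2.2⟩
          · exact fun h => ⟨h.1, by linarith [h.1], h.2⟩
        have h1τ : 0 ≤ 1 - τ := by linarith
        rw [s1, s2, Real.volume_Ico, Real.volume_Icc, sub_zero,
          ← ENNReal.ofReal_mul (by positivity), ← ENNReal.ofReal_mul (by positivity),
          ← ENNReal.ofReal_add (by positivity) (by positivity)]
        congr 1
        field_simp
        ring

end Curve

/-! ### The bounded Lipschitz distance -/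

theorem constBL_twoNode : constBL twoNode = 1 := by
  have : (⨆ i, ∑ j, twoNode i j) = 1 := by
    have h : ∀ i, ∑ j, twoNode i j = 1 := fun i => by
      fin_cases i <;> simp [twoNode, Fin.sum_univ_two]
    simp [h]
  rw [constBL, this]
  simp

theorem sqrt_sq_eq_self (x : ℝ≥0∞) : (x ^ 2) ^ (1 / 2 : ℝ) = x := by
  rw [← ENNReal.rpow_natCast, ← ENNReal.rpow_mul]
  norm_num

/-- By continuity the set where |η| > 1 is open, and a Lebesgue-null open set is empty; this
upgrades the essential bound to a pointwise one, usable against atoms. -/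
theorem abs_le_one_of_W1infNorm_le {η : ℝ → ℝ} (hη : Continuous η) (h : W1infNorm η ≤ 1) (x : ℝ) :
    |η x| ≤ 1 := by
  have h1 : eLpNorm η ⊤ volume ≤ 1 := by
    rw [← sqrt_sq_eq_self (eLpNorm η ⊤ volume)]
    exact (ENNReal.rpow_le_rpow le_self_add (by norm_num)).trans h
  by_contra hcon
  have hopen : IsOpen {y | 1 < |η y|} := isOpen_lt continuous_const hη.abs
  have hnull : volume {y | 1 < |η y|} = 0 := by
    have hae : ∀ᵐ y, |η y| ≤ 1 := by
      filter_upwards [ae_le_eLpNormEssSup (f := η) (μ := volume)] with y hy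
      rw [← eLpNorm_exponent_top] at hy
      have := hy.trans h1
      rw [Real.enorm_eq_ofReal_abs] at this
      simpa using this
    simpa [ae_iff] using hae
  have := (hopen.measure_eq_zero_iff volume).1 hnull
  exact (this ▸ (not_le.1 hcon : x ∈ {y | 1 < |η y|}) : x ∈ (∅ : Set ℝ))

theorem normBL_le (μ ν : Measure ℝ) [IsFiniteMeasure μ] [IsFiniteMeasure ν] :
    normBL μ ν ≤ μ univ + ν univ := by
  refine iSup_le fun η => iSup_le fun hη => iSup_le fun _ => iSup_le fun h => ?_
  have hb := abs_le_one_of_W1infNorm_le hη.continuous h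
  have hi : ∀ (m : Measure ℝ) [IsFiniteMeasure m], |∫ x, η x ∂m| ≤ m.real univ := fun m _ => by
    have := norm_integral_le_of_norm_le_const (μ := m) (f := η) (C := 1)
      (Filter.Eventually.of_forall hb)
    simpa using this
  rw [ENNReal.ofReal_le_iff_le_toReal (by simp), ENNReal.toReal_add (by simp) (by simp)]
  have h1 := (abs_le.1 (hi μ)).2
  have h2 := (abs_le.1 (hi ν)).1
  simp only [Measure.real] at h1 h2
  linarith

theorem eLpNorm_top_le_of_abs_le {f : ℝ → ℝ} {C : ℝ} (h : ∀ x, |f x| ≤ C) :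
    eLpNorm f ⊤ volume ≤ ENNReal.ofReal C := by
  rw [eLpNorm_exponent_top]
  exact eLpNormEssSup_le_of_ae_bound (Filter.Eventually.of_forall h)

theorem W1infNorm_le_one {f : ℝ → ℝ} {A B : ℝ} (hA : ∀ x, |f x| ≤ A) (hB : ∀ x, |deriv f x| ≤ B)
    (h : A ^ 2 + B ^ 2 ≤ 1) : W1infNorm f ≤ 1 := by
  have hA0 : 0 ≤ A := (abs_nonneg _).trans (hA 0)
  have hB0 : 0 ≤ B := (abs_nonneg _).trans (hB 0)
  rw [W1infNorm, ← ENNReal.one_rpow (1 / 2 : ℝ)]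
  refine ENNReal.rpow_le_rpow ?_ (by norm_num)
  calc _ ≤ ENNReal.ofReal A ^ 2 + ENNReal.ofReal B ^ 2 :=
        add_le_add (pow_le_pow_left₀ zero_le (eLpNorm_top_le_of_abs_le hA) 2)
          (pow_le_pow_left₀ zero_le (eLpNorm_top_le_of_abs_le hB) 2)
    _ = ENNReal.ofReal (A ^ 2 + B ^ 2) := by
        rw [ENNReal.ofReal_add (by positivity) (by positivity), ENNReal.ofReal_pow hA0,
          ENNReal.ofReal_pow hB0]
    _ ≤ 1 := by simpa using h

/-- Almost optimal test functions for a single atom. -/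
theorem exists_test_atom {ε : ℝ} (hε : 0 < ε) (hε1 : ε ≤ 1) :
    ∃ η : ℝ → ℝ, ContDiff ℝ ∞ η ∧ HasCompactSupport η ∧ W1infNorm η ≤ 1 ∧
      W1infNorm (fun x => -η x) ≤ 1 ∧ η 0 = 1 - ε := by
  obtain ⟨χ, h1, h2, h3, h4, h5⟩ := exists_space_cutoff hε
  have hA : ∀ x, |(1 - ε) * χ x| ≤ 1 - ε := fun x => by
    rw [abs_mul, abs_of_nonneg (by linarith)]
    exact mul_le_of_le_one_right (by linarith) (h3 x)
  have hB : ∀ x, |deriv (fun x => (1 - ε) * χ x) x| ≤ ε := fun x => by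
    rw [deriv_const_mul_field, abs_mul, abs_of_nonneg (by linarith)]
    exact (mul_le_of_le_one_left (abs_nonneg _) (by linarith)).trans (h5 x)
  have hs : (1 - ε) ^ 2 + ε ^ 2 ≤ 1 := by nlinarith
  refine ⟨fun x => (1 - ε) * χ x, by fun_prop, h2.mul_left, W1infNorm_le_one hA hB hs,
    W1infNorm_le_one (fun x => ?_) (fun x => ?_) hs, by simp [h4]⟩
  · rw [abs_neg]
    exact hA x
  · rw [deriv.fun_neg, abs_neg]
    exact hB x

theorem one_le_normBL_of_forall {μ ν : Measure ℝ}
    (h : ∀ ε : ℝ, 0 < ε → ε ≤ 1 → ∃ η : ℝ → ℝ, ContDiff ℝ ∞ η ∧ HasCompactSupport η ∧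
      W1infNorm η ≤ 1 ∧ ∫ x, η x ∂μ - ∫ x, η x ∂ν = 1 - ε) : 1 ≤ normBL μ ν := by
  rw [← ENNReal.ofReal_one]
  refine ofReal_le_of_forall_sub fun ε hε => ?_
  obtain ⟨η, h1, h2, h3, h4⟩ := h (min ε 1) (by positivity) (min_le_right _ _)
  calc ENNReal.ofReal (1 - ε) ≤ ENNReal.ofReal (∫ x, η x ∂μ - ∫ x, η x ∂ν) := by
        rw [h4]
        exact ENNReal.ofReal_le_ofReal (by linarith [min_le_left ε 1])
    _ ≤ normBL μ ν := le_iSup_of_le η (le_iSup_of_le h1 (le_iSup_of_le h2 (le_iSup_of_le h3 le_rfl)))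

theorem normBL_dirac_zero : normBL (Measure.dirac 0) 0 = 1 := by
  refine le_antisymm ((normBL_le _ _).trans (by simp)) (one_le_normBL_of_forall fun ε hε hε1 => ?_)
  obtain ⟨η, h1, h2, h3, -, h5⟩ := exists_test_atom hε hε1
  exact ⟨η, h1, h2, h3, by simp [h5]⟩

theorem normBL_zero_dirac : normBL 0 (Measure.dirac 0) = 1 := by
  refine le_antisymm ((normBL_le _ _).trans (by simp)) (one_le_normBL_of_forall fun ε hε hε1 => ?_)
  obtain ⟨η, h1, h2, -, h4, h5⟩ := exists_test_atom hε hε1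
  exact ⟨fun x => -η x, h1.neg, h2.neg, h4, by simp [h5]⟩

theorem dBL_exchange : dBL (twoAtoms 0 0) (twoAtoms 0 1) = 2 ^ (1 / 2 : ℝ) := by
  simp only [dBL, Fin.sum_univ_two, twoAtoms, Matrix.cons_val_zero, Matrix.cons_val_one, sub_zero,
    sub_self, ENNReal.ofReal_one, ENNReal.ofReal_zero, one_smul, zero_smul, normBL_dirac_zero,
    normBL_zero_dirac]
  norm_num

theorem dBL_le {μ ν : Fin 2 → Measure ℝ} (hμ : IsVVProb μ) (hν : IsVVProb ν) :
    dBL μ ν ≤ 8 ^ (1 / 2 : ℝ) := by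
  refine ENNReal.rpow_le_rpow ?_ (by norm_num)
  have h : ∀ i, normBL (μ i) (ν i) ^ 2 ≤ 4 := fun i => by
    have := isFiniteMeasure_of_isVVProb hμ i
    have := isFiniteMeasure_of_isVVProb hν i
    calc normBL (μ i) (ν i) ^ 2 ≤ (1 + 1) ^ 2 :=
          pow_le_pow_left₀ zero_le ((normBL_le _ _).trans
            (add_le_add (measure_univ_le_one hμ i) (measure_univ_le_one hν i))) 2
      _ = 4 := by norm_num
  rw [Fin.sum_univ_two]
  exact (add_le_add (h 0) (h 1)).trans (by norm_num)

/-! ### Lower bounds for the dynamic distance in the examples -/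

theorem integral_twoAtoms_zero {a b : ℝ} (hb : b ≤ 1) (f : ℝ → ℝ) :
    ∫ x, f x ∂(twoAtoms a b 0) = (1 - b) * f 0 := by
  simp only [twoAtoms, Matrix.cons_val_zero]
  rw [integral_smul_measure, integral_dirac, ENNReal.toReal_ofReal (by linarith), smul_eq_mul]

theorem integral_twoAtoms_one {a b : ℝ} (hb : 0 ≤ b) (f : ℝ → ℝ) :
    ∫ x, f x ∂(twoAtoms a b 1) = b * f a := by
  simp only [twoAtoms, Matrix.cons_val_zero, Matrix.cons_val_one]
  rw [integral_smul_measure, integral_dirac, ENNReal.toReal_ofReal hb, smul_eq_mul]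

theorem two_le_dynW_exchange :
    2 ^ (1 / 2 : ℝ) ≤ dynW arith twoNode (twoAtoms 0 0) (twoAtoms 0 1) := by
  refine ENNReal.rpow_le_rpow ?_ (by norm_num)
  refine le_iInf fun ρ => le_iInf fun u => le_iInf fun v => le_iInf fun h => le_iInf fun h0 =>
    le_iInf fun h1 => ?_
  set E := ∫⁻ t in Icc (0 : ℝ) 1,
    vvNormSq arith twoNode (ρ t) (fun i x => u i x t) (fun i j x => v i j x t)
  by_cases hE : E = ⊤
  · simp [hE]
  rw [show (2 : ℝ≥0∞) = ENNReal.ofReal 2 by simp]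
  refine ofReal_le_of_forall_sub fun ε hε => ?_
  -- Chosen so that 2B² ≤ 2B ≤ ε: the transport error of the test functions is absorbed.
  set B := min (ε / 2) 1
  have hB0 : 0 < B := by positivity
  have hBε : B ≤ ε / 2 := min_le_left _ _
  have hB1 : B ≤ 1 := min_le_right _ _
  obtain ⟨χ, c1, c2, c3, c4, c5⟩ := exists_space_cutoff hB0
  -- Opposite signs make the gain equal to 2χ(0) = 2, so 4 ≤ 2B² + 2 + E.
  have key := h.two_mul_sub_le (ψ := ![fun x => -χ x, χ]) (B := B)
    (fun i => by fin_cases i; exacts [c1.neg, c1])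
    (fun i => by fin_cases i; exacts [c2.neg, c2])
    (fun i x => by
      fin_cases i
      · simpa using c3 x
      · exact c3 x)
    (fun i x => by
      fin_cases i
      · simpa [deriv.fun_neg] using c5 x
      · exact c5 x)
  rw [Fin.sum_univ_two, h0, h1, integral_twoAtoms_zero le_rfl, integral_twoAtoms_one zero_le_one,
    integral_twoAtoms_zero zero_le_one, integral_twoAtoms_one le_rfl] at key
  simp only [Matrix.cons_val_zero, Matrix.cons_val_one, c4] at key
  change _ ≤ _ + E at key
  rw [← ENNReal.ofReal_toReal hE, ← ENNReal.ofReal_add (by positivity) (by positivity),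
    ENNReal.ofReal_le_ofReal_iff (by positivity)] at key
  rw [ENNReal.ofReal_le_iff_le_toReal hE]
  nlinarith

/-- Far away target measures are far away for the dynamic distance. -/
theorem exists_lt_dynW :
    ∃ a : ℝ, 8 ^ (1 / 2 : ℝ) < dynW arith twoNode (twoAtoms 0 0) (twoAtoms a 1) := by
  obtain ⟨χ, c1, c2, c3, c4, c5⟩ := exists_space_cutoff (show (0 : ℝ) < 1 / 10 by norm_num)
  obtain ⟨a, ha⟩ : ∃ a, χ a = 0 := by
    by_contra! hcon
    have : tsupport χ = univ := by
      rw [tsupport, Function.support_eq_univ hcon, closure_univ]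
    exact noncompact_univ ℝ (this ▸ c2.isCompact)
  refine ⟨a, lt_of_lt_of_le (ENNReal.rpow_lt_rpow (show (8 : ℝ≥0∞) < 18 by norm_num)
    (by norm_num)) (ENNReal.rpow_le_rpow ?_ (by norm_num))⟩
  refine le_iInf fun ρ => le_iInf fun u => le_iInf fun v => le_iInf fun h => le_iInf fun h0 =>
    le_iInf fun h1 => ?_
  set E := ∫⁻ t in Icc (0 : ℝ) 1,
    vvNormSq arith twoNode (ρ t) (fun i x => u i x t) (fun i j x => v i j x t)
  by_cases hE : E = ⊤
  · simp [hE]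
  -- This test function has slope at most 1 and increases by 10 from 0 to a, hence 20 ≤ 2 + E.
  have key := h.two_mul_total_sub_le (ψ := fun x => -10 * χ x) (B := 1) (by fun_prop) c2.mul_left
    (fun x => by
      rw [deriv_const_mul_field, abs_mul]
      have := c5 x
      norm_num at this ⊢
      linarith)
  rw [Fin.sum_univ_two, h0, h1, integral_twoAtoms_zero le_rfl, integral_twoAtoms_one zero_le_one,
    integral_twoAtoms_zero zero_le_one, integral_twoAtoms_one le_rfl, c4, ha] at key
  change _ ≤ _ + E at key
  rw [← ENNReal.ofReal_toReal hE, ← ENNReal.ofReal_add (by positivity) (by positivity),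
    ENNReal.ofReal_le_ofReal_iff (by positivity)] at key
  rw [show (18 : ℝ≥0∞) = ENNReal.ofReal 18 by simp, ENNReal.ofReal_le_iff_le_toReal hE]
  linarith

/-! ### Comparison of the distances -/

theorem rpow_half_ofReal {x : ℝ} (hx : 0 ≤ x) :
    ENNReal.ofReal x ^ (1 / 2 : ℝ) = ENNReal.ofReal (√x) := by
  rw [ENNReal.ofReal_rpow_of_nonneg hx (by norm_num), Real.sqrt_eq_rpow]

theorem rpow_half_lt_top {x : ℝ≥0∞} (hx : x ≠ ⊤) : x ^ (1 / 2 : ℝ) < ⊤ :=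
  ENNReal.rpow_lt_top_of_nonneg (by norm_num) hx

theorem two_rpow_half_pos : (0 : ℝ≥0∞) < 2 ^ (1 / 2 : ℝ) :=
  ENNReal.rpow_pos (by simp) (by simp)

theorem dynW_exchange :
    dynW arith twoNode (twoAtoms 0 0) (twoAtoms 0 1) = 2 ^ (1 / 2 : ℝ) := by
  refine le_antisymm ?_ two_le_dynW_exchange
  simpa using dynW_twoAtoms_le (b := 1) (τ := 1) (c := 0) zero_le_one le_rfl one_pos le_rfl

theorem semiD_exchange :
    semiD arith twoNode (twoAtoms 0 0) (twoAtoms 0 1) = 2 ^ (1 / 2 : ℝ) := by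
  refine le_antisymm ((semiD_twoAtoms_le_staticW _ _ 0 0 le_rfl zero_le_one zero_le_one
    le_rfl).trans ?_) ?_
  · simpa using staticW_twoAtoms_le 0 zero_le_one le_rfl
  · simpa using le_semiD_twoAtoms (a := 0) (b := 1) (Or.inr rfl)

theorem staticW_exchange :
    staticW arith twoNode (twoAtoms 0 0) (twoAtoms 0 1) = 2 ^ (1 / 2 : ℝ) := by
  refine le_antisymm ?_ ?_
  · simpa using staticW_twoAtoms_le 0 zero_le_one le_rfl
  · simpa using le_staticW_twoAtoms 0 1

/-- Exchanging up to τ = 3/4 and then moving at unit speed gives squared cost at most 2/3 + 1/8 =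
19/24, below (1/2)(1/16 + 2) = 33/32. -/
theorem dynW_lt_semiD :
    dynW arith twoNode (twoAtoms 0 0) (twoAtoms (1 / 4) (1 / 2)) <
      semiD arith twoNode (twoAtoms 0 0) (twoAtoms (1 / 4) (1 / 2)) := by
  have h1 := dynW_twoAtoms_le (b := 1 / 2) (τ := 3 / 4) (c := 1) (by norm_num) (by norm_num)
    (by norm_num) (by norm_num)
  rw [show (1 : ℝ) * (1 - 3 / 4) = 1 / 4 by norm_num] at h1
  have h2 := le_semiD_twoAtoms (a := 1 / 4) (b := 1 / 2) (Or.inl (by norm_num))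
  refine h1.trans_lt (lt_of_lt_of_le (ENNReal.rpow_lt_rpow ?_ (by norm_num)) h2)
  rw [ENNReal.ofReal_lt_ofReal_iff (by norm_num)]
  norm_num

theorem semiD_twoAtoms_lt_top (a : ℝ) {b : ℝ} (h0 : 0 ≤ b) (h1 : b ≤ 1) :
    semiD arith twoNode (twoAtoms 0 0) (twoAtoms a b) < ⊤ :=
  ((semiD_twoAtoms_le_staticW _ _ 0 a le_rfl zero_le_one h0 h1).trans
    (staticW_twoAtoms_le a h0 h1)).trans_lt (rpow_half_lt_top (by simp))

theorem semiD_lt_staticW :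
    semiD arith twoNode (twoAtoms 0 0) (twoAtoms 0 (1 / 2)) <
      staticW arith twoNode (twoAtoms 0 0) (twoAtoms 0 (1 / 2)) := by
  refine semiD_exchange_half_le.trans_lt (lt_of_lt_of_le (ENNReal.rpow_lt_rpow ?_ (by norm_num))
    (le_staticW_twoAtoms 0 (1 / 2)))
  rw [ENNReal.ofReal_lt_ofReal_iff (by norm_num)]
  norm_num

/-- The two legs add up to at most (5/4)√(1/2), with square 25/32, while the square of the direct
distance is at least 33/32. -/
theorem semiD_triangle_fails :
    semiD arith twoNode (twoAtoms 0 0) (twoAtoms 0 (1 / 2)) +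
        semiD arith twoNode (twoAtoms 0 (1 / 2)) (twoAtoms (1 / 4) (1 / 2)) <
      semiD arith twoNode (twoAtoms 0 0) (twoAtoms (1 / 4) (1 / 2)) := by
  refine (add_le_add semiD_exchange_half_le (semiD_translate_half_le (1 / 4))).trans_lt
    (lt_of_lt_of_le ?_ (le_semiD_twoAtoms (a := 1 / 4) (b := 1 / 2) (Or.inl (by norm_num))))
  rw [rpow_half_ofReal (by norm_num), rpow_half_ofReal (by norm_num),
    rpow_half_ofReal (by norm_num), ← ENNReal.ofReal_add (by positivity) (by positivity),
    ENNReal.ofReal_lt_ofReal_iff (by positivity)]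
  refine Real.lt_sqrt_of_sq_lt ?_
  have h : √((1 / 4 : ℝ) ^ 2 / 2) = 1 / 4 * √(1 / 2) := by
    rw [show (1 / 4 : ℝ) ^ 2 / 2 = (1 / 4) ^ 2 * (1 / 2) by ring,
      Real.sqrt_mul (by norm_num), Real.sqrt_sq (by norm_num)]
  have hs : √(1 / 2 : ℝ) ^ 2 = 1 / 2 := Real.sq_sqrt (by norm_num)
  rw [h]
  nlinarith

end VVOT

theorem proposition1p5 :
    ∃ θ : ℝ → ℝ → ℝ, VVOT.IsInterpolation θ ∧
      -- first inequality: min {1, Q^{-1/2}} d_BL ≤ W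
      (VVOT.ConstantSharp (VVOT.constBL VVOT.twoNode) VVOT.dBL (VVOT.dynW θ VVOT.twoNode) ∧
        VVOT.StrictSomewhere (VVOT.constBL VVOT.twoNode) VVOT.dBL (VVOT.dynW θ VVOT.twoNode)) ∧
      -- second inequality: W ≤ D
      (VVOT.ConstantSharp 1 (VVOT.dynW θ VVOT.twoNode) (VVOT.semiD θ VVOT.twoNode) ∧
        VVOT.StrictSomewhere 1 (VVOT.dynW θ VVOT.twoNode) (VVOT.semiD θ VVOT.twoNode)) ∧
      -- third inequality: D ≤ W_{2,𝒲}
      (VVOT.ConstantSharp 1 (VVOT.semiD θ VVOT.twoNode) (VVOT.staticW θ VVOT.twoNode) ∧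
        VVOT.StrictSomewhere 1 (VVOT.semiD θ VVOT.twoNode) (VVOT.staticW θ VVOT.twoNode)) ∧
      -- the triangle inequality fails for D
      (∃ μ ν σ : Fin 2 → MeasureTheory.Measure ℝ,
        VVOT.IsVVProb₂ μ ∧ VVOT.IsVVProb₂ ν ∧ VVOT.IsVVProb₂ σ ∧
          VVOT.semiD θ VVOT.twoNode μ ν + VVOT.semiD θ VVOT.twoNode ν σ <
            VVOT.semiD θ VVOT.twoNode μ σ) := by
  have a0 : VVOT.IsVVProb₂ (VVOT.twoAtoms 0 0) := VVOT.isVVProb₂_twoAtoms 0 le_rfl zero_le_one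
  have a1 : ∀ a, VVOT.IsVVProb₂ (VVOT.twoAtoms a 1) := fun a => VVOT.isVVProb₂_twoAtoms a zero_le_one le_rfl
  have ah : ∀ a, VVOT.IsVVProb₂ (VVOT.twoAtoms a (1 / 2)) := fun a =>
    VVOT.isVVProb₂_twoAtoms a (by norm_num) (by norm_num)
  have hfin : (2 : ENNReal) ^ (1 / 2 : ℝ) < ⊤ := VVOT.rpow_half_lt_top (by simp)
  obtain ⟨a, ha⟩ := VVOT.exists_lt_dynW
  refine ⟨VVOT.arith, VVOT.isInterpolation_arith, ⟨?_, ?_⟩, ⟨?_, ?_⟩, ⟨?_, ?_⟩, ?_⟩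
  · refine ⟨_, _, a0, a1 0, ?_, ?_, ?_⟩
    · rw [VVOT.dynW_exchange]; exact VVOT.two_rpow_half_pos
    · rw [VVOT.dynW_exchange]; exact hfin
    · rw [VVOT.dynW_exchange, VVOT.constBL_twoNode, one_mul, VVOT.dBL_exchange]
  · refine ⟨_, _, a0, a1 a, ?_, ?_⟩
    · rw [VVOT.constBL_twoNode, one_mul]
      exact (VVOT.dBL_le a0.1 (a1 a).1).trans_lt ha
    -- Only finiteness is needed: speed 2a over the second half of the time interval reaches a.
    · have := VVOT.dynW_twoAtoms_le (b := 1) (τ := 1 / 2) (c := 2 * a) zero_le_one le_rfl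
        (by norm_num) (by norm_num)
      rw [show 2 * a * (1 - 1 / 2) = a by ring] at this
      exact this.trans_lt (VVOT.rpow_half_lt_top (by simp))
  · refine ⟨_, _, a0, a1 0, ?_, ?_, ?_⟩
    · rw [VVOT.semiD_exchange]; exact VVOT.two_rpow_half_pos
    · rw [VVOT.semiD_exchange]; exact hfin
    · rw [VVOT.dynW_exchange, one_mul, VVOT.semiD_exchange]
  · refine ⟨_, _, a0, ah (1 / 4), ?_, VVOT.semiD_twoAtoms_lt_top _ (by norm_num) (by norm_num)⟩
    rw [one_mul]
    exact VVOT.dynW_lt_semiD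
  · refine ⟨_, _, a0, a1 0, ?_, ?_, ?_⟩
    · rw [VVOT.staticW_exchange]; exact VVOT.two_rpow_half_pos
    · rw [VVOT.staticW_exchange]; exact hfin
    · rw [VVOT.semiD_exchange, one_mul, VVOT.staticW_exchange]
  · refine ⟨_, _, a0, ah 0, ?_, (VVOT.staticW_twoAtoms_le 0 (by norm_num)
      (by norm_num)).trans_lt (VVOT.rpow_half_lt_top (by simp))⟩
    rw [one_mul]
    exact VVOT.semiD_lt_staticW
  · exact ⟨_, _, _, a0, ah 0, ah (1 / 4), VVOT.semiD_triangle_fails⟩
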